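/- Let $K$ be a non-archimedean local field (of characteristic $0$ or $p$) with ring of integers $\mathcal{O}$, uniformizer $\pi$ and residue field $\mathbb{F}_q$ of characteristic $p$; let $\overline{\mathbb{F}}_q$ be an algebraic closure of $\mathbb{F}_q$, $n\ge 1$ an integer, and $m\in\mathbb{Z}$. For $h\ge 0$ let $\mathbb{O}_h$ be the functor from $\mathbb{F}_q$-algebras to rings given by the Greenberg realization of $\mathcal{O}/\pi^h$: $\mathbb{O}_h(R)$ is the quotient of $\mathcal{O}\otimes_{W(\mathbb{F}_q)}W(R)$ by the ideal generated by all $a\otimes V^s w$ with $p^s a\in\pi^h\mathcal{O}$ ($W$ denotes $p$-typical Witt vectors, $V$ the Verschiebung, and $W(\mathbb{F}_q)\to\mathcal{O}$ is the canonical homomorphism lifting the identity of $\mathbb{F}_q$). Thus $\mathbb{O}_h(R)=\mathcal{O}/\pi^h\otimes_{W(\mathbb{F}_q)}W(R)$ for perfect $R$, and $\mathbb{O}_h(R)=R[\pi]/(\pi^h)$ for all $R$ if $\operatorname{char}K=p$. Let $\varphi$ be the endomorphism of $\mathbb{O}_h$ induced by $x\mapsto x^q$ on $R$. For $h\ge 1$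 let $\widetilde X^{(0)}_h(R)$ be the set of tuples $(a_0,a_1,\dots,a_{n-1})\in\mathbb{O}_h(R)^\times\times\mathbb{O}_{h-1}(R)^{n-1}$ such that the determinant in $\mathbb{O}_h(R)$ of the matrix $A_h(a_0,\dots,a_{n-1})$ with rows and columns $i,j=0,\dots,n-1$ and $(i,j)$ entry $\varphi^i(a_{j-i})$ for $i\le j$, $\pi\varphi^i(a_{n+j-i})$ for $i>j$, is fixed by $\varphi$. For general $m$ let $\widetilde X^{(m)}_h$ consist of the formal products $A\varpi^m$ with $A\in\widetilde X^{(0)}_h$, where $\varpi$ is the $n\times n$ matrix with $1$'s on the superdiagonal, $\pi$ in the lower left corner and $0$ elsewhere. Restrict these functors to $\overline{\mathbb{F}}_q$-algebras. Let $L$ be the unramified extension of $K$ of degree $n$ with residue field $\mathbb{F}_{q^n}\subset\overline{\mathbb{F}}_q$, and put $Z_h=(\mathcal{O}_L/\pi^h\mathcal{O}_L)^\times$. The group $Z_h$ acts on $\widetilde X^{(m)}_h$ by left multiplication by the matrices $\operatorname{diag}(z,\varphi(z),\dots,\varphi^{n-1}(z))$, that is, by $a_j\mapsto z a_j$. For $h\ge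 2$ put $W_h=\operatorname{Ker}(Z_h\to Z_{h-1})$. Then for every $h\ge1$ the functor $\widetilde X^{(m)}_h$ is represented by an affine scheme of finite type over $\overline{\mathbb{F}}_q$. For every $h\ge 2$, the action of $W_h$ on $\widetilde X^{(m)}_h$ preserves every fiber of the natural morphism $\widetilde X^{(m)}_h\to\widetilde X^{(m)}_{h-1}$ (this morphism is $W_h$-invariant); the induced morphism $W_h\backslash\widetilde X^{(m)}_h\to\widetilde X^{(m)}_{h-1}$ is smooth, and for every field $F$ and every morphism $y\colon\operatorname{Spec}F\to\widetilde X^{(m)}_{h-1}$ its fiber over $y$ is isomorphic, as an $F$-scheme, to the affine space $\mathbb{A}^{n-1}_F$ (in particular, its fibers over $\overline{\mathbb{F}}_q$-points are isomorphic to $\mathbb{A}^{n-1}$ over $\overline{\mathbb{F}}_q$). In fact $W_h\backslash\widetilde X^{(m)}_h$ is isomorphic, as a scheme over $\widetilde X^{(m)}_{h-1}$, to $\widetilde X^{(m)}_{h-1}\times\mathbb{A}^{n-1}$. -/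

import Mathlib

open scoped TensorProduct ValuativeRel

universe u

namespace DivisionLusztig

noncomputable section

open IsLocalRing CategoryTheory AlgebraicGeometry IsAdicComplete

/-! ### The structure map `W(k) → O` of a complete local ring with finite residue field `k` -/

section WittStructure

variable (p : ℕ) [Fact p.Prime] (O : Type u) [CommRing O] [IsLocalRing O]

lemma ker_map_residue_le (n : ℕ) [CharP (ResidueField O) p] :
    RingHom.ker (WittVector.map (p := p) (residue O)) ≤
      RingHom.ker ((Ideal.Quotient.mk (maximalIdeal O ^ (n + 1))).comp
        (WittVector.ghostComponent (p := p) n)) := by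
  intro x hx
  have hp : (p : O) ∈ maximalIdeal O := by
    rw [← residue_eq_zero_iff, map_natCast, CharP.cast_eq_zero]
  have hc : ∀ i, x.coeff i ∈ maximalIdeal O := by
    intro i
    have h := congrArg (fun y => WittVector.coeff y i) (RingHom.mem_ker.mp hx)
    simpa [WittVector.map_coeff, residue_eq_zero_iff] using h
  rw [RingHom.mem_ker, RingHom.comp_apply, Ideal.Quotient.eq_zero_iff_mem,
    WittVector.ghostComponent_apply, wittPolynomial, map_sum]
  refine Ideal.sum_mem _ fun i hi => ?_
  have hi' : i ≤ n := Nat.lt_succ_iff.mp (Finset.mem_range.mp hi)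
  have he : (MvPolynomial.aeval x.coeff) ((MvPolynomial.monomial (R := ℤ)
      (Finsupp.single i (p ^ (n - i)))) (p ^ i)) = (p : O) ^ i * (x.coeff i) ^ (p ^ (n - i)) := by
    simp [MvPolynomial.aeval_monomial, map_pow]
  rw [he]
  have h1 : (p : O) ^ i * (x.coeff i) ^ (p ^ (n - i)) ∈
      maximalIdeal O ^ i * maximalIdeal O ^ (p ^ (n - i)) :=
    Ideal.mul_mem_mul (Ideal.pow_mem_pow hp _) (Ideal.pow_mem_pow (hc i) _)
  rw [← pow_add] at h1
  refine Ideal.pow_le_pow_right ?_ h1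
  have h2 : n - i < p ^ (n - i) := Nat.lt_pow_self (Nat.Prime.one_lt Fact.out)
  omega

variable [CharP (ResidueField O) p]

/-- The ring homomorphism `W(k) → O/𝔪ⁿ⁺¹` induced by the `n`-th ghost component of `W(O)`. -/
def ghostMod (n : ℕ) : WittVector p (ResidueField O) →+* O ⧸ maximalIdeal O ^ (n + 1) :=
  RingHom.liftOfSurjective (WittVector.map (p := p) (residue O))
    (WittVector.map_surjective _ residue_surjective)
    ⟨(Ideal.Quotient.mk (maximalIdeal O ^ (n + 1))).comp (WittVector.ghostComponent (p := p) n),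
      ker_map_residue_le p O n⟩

lemma ghostMod_map (n : ℕ) (x : WittVector p O) :
    ghostMod p O n (WittVector.map (residue O) x) =
      Ideal.Quotient.mk (maximalIdeal O ^ (n + 1)) (WittVector.ghostComponent n x) :=
  RingHom.liftOfSurjective_comp_apply ..

variable [Finite (ResidueField O)]

/-- The homomorphism `W(k) → O/𝔪ⁿ⁺¹`, `[x] ↦ yᵖ^ⁿ`, where `y` lifts the `pⁿ`-th root of `x`. -/
def wittMod (n : ℕ) : WittVector p (ResidueField O) →+* O ⧸ maximalIdeal O ^ (n + 1) :=
  (ghostMod p O n).comp (WittVector.map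
    ((((frobeniusEquiv (ResidueField O) p).symm ^ n : ResidueField O ≃+* ResidueField O)) :
      ResidueField O →+* ResidueField O))

lemma wittMod_teichmuller (n : ℕ) (y : O) (x : ResidueField O)
    (h : residue O y ^ p ^ n = x) :
    wittMod p O n (WittVector.teichmuller p x) =
      Ideal.Quotient.mk (maximalIdeal O ^ (n + 1)) (y ^ p ^ n) := by
  have hx : ((frobeniusEquiv (ResidueField O) p).symm ^ n) x = residue O y := by
    subst h
    induction n with
    | zero => simp
    | succ n ih =>
      rw [pow_succ, pow_succ, pow_mul]
      change ((frobeniusEquiv (ResidueField O) p).symm ^ n)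
        ((frobeniusEquiv (ResidueField O) p).symm ((residue O y ^ p ^ n) ^ p)) = _
      have : (frobeniusEquiv (ResidueField O) p).symm ((residue O y ^ p ^ n) ^ p)
          = residue O y ^ p ^ n := by
        rw [RingEquiv.symm_apply_eq, frobeniusEquiv_apply, frobenius_def]
      rw [this, ih]
  have : wittMod p O n (WittVector.teichmuller p x) =
      ghostMod p O n (WittVector.map (residue O) (WittVector.teichmuller p y)) := by
    simp only [wittMod, RingHom.comp_apply, WittVector.map_teichmuller, RingHom.coe_coe, hx]
  rw [this, ghostMod_map, WittVector.ghostComponent_teichmuller]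

lemma factor_wittMod (n : ℕ) :
    (Ideal.Quotient.factorPowSucc (maximalIdeal O) (n + 1)).comp (wittMod p O (n + 1)) =
      wittMod p O n := by
  have hp : (p : O) ∈ maximalIdeal O := by
    rw [← residue_eq_zero_iff, map_natCast, CharP.cast_eq_zero]
  apply WittVector.eq_of_apply_teichmuller_eq
  · refine ⟨n + 1, ?_⟩
    rw [← map_natCast (Ideal.Quotient.mk (maximalIdeal O ^ (n + 1))), ← map_pow,
      Ideal.Quotient.eq_zero_iff_mem]
    exact Ideal.pow_mem_pow hp _
  · intro x
    obtain ⟨z, hz⟩ := (bijective_iterateFrobenius (ResidueField O) p (n + 1)).2 x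
    obtain ⟨y, rfl⟩ := residue_surjective z
    rw [iterateFrobenius_def] at hz
    rw [RingHom.comp_apply, wittMod_teichmuller p O (n + 1) y x hz,
      wittMod_teichmuller p O n (y ^ p) x (by rw [map_pow, ← pow_mul, ← pow_succ', hz]),
      ← pow_mul, ← pow_succ']
    rfl

variable [IsAdicComplete (maximalIdeal O) O]

/-- The canonical homomorphism `W(k) → O` lifting the identity of `k`. In mixed characteristic
it identifies `W(k)` with the ring of integers of the maximal unramified subfield; in equal
characteristic it is `W(k) → k → O`. -/
def wittHom : WittVector p (ResidueField O) →+* O :=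
  StrictMono.liftRingHom (maximalIdeal O) Order.succ_strictMono (wittMod p O)
    (factor_wittMod p O _)

lemma residue_wittHom (w : WittVector p (ResidueField O)) :
    residue O (wittHom p O w) = w.coeff 0 := by
  have h : Ideal.Quotient.mk (maximalIdeal O ^ (0 + 1)) (wittHom p O w) = wittMod p O 0 w :=
    StrictMono.mk_liftRingHom (maximalIdeal O) Order.succ_strictMono (wittMod p O)
      (factor_wittMod p O _) w
  obtain ⟨v, rfl⟩ := WittVector.map_surjective (p := p) _ (residue_surjective (R := O)) w
  have h2 : wittMod p O 0 (WittVector.map (residue O) v) =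
      Ideal.Quotient.mk (maximalIdeal O ^ (0 + 1)) (WittVector.ghostComponent 0 v) := by
    rw [← ghostMod_map]
    simp only [wittMod, RingHom.comp_apply, pow_zero]
    congr 1
  rw [h2, Ideal.Quotient.eq, zero_add, pow_one] at h
  have h3 : residue O (wittHom p O (WittVector.map (residue O) v)) =
      residue O (WittVector.ghostComponent 0 v) := Ideal.Quotient.eq.mpr h
  rw [h3]
  simp [WittVector.ghostComponent_apply]

/-- `O` as an algebra over `W(k)`. -/
instance wittAlgebra : Algebra (WittVector p (ResidueField O)) O := (wittHom p O).toAlgebra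

end WittStructure

/-- For a `k`-algebra `R`, the ring `W(R)` as an algebra over `W(k)`. -/
instance wittAlgebraMap (p : ℕ) [Fact p.Prime] (k R : Type u) [CommRing k] [CommRing R]
    [Algebra k R] : Algebra (WittVector p k) (WittVector p R) :=
  (WittVector.map (algebraMap k R)).toAlgebra

/-- `W(f) : W(R) → W(S)` as a homomorphism of `W(k)`-algebras. -/
def wittMap (p : ℕ) [Fact p.Prime] {k R S : Type u} [CommRing k] [CommRing R] [CommRing S]
    [Algebra k R] [Algebra k S] (f : R →ₐ[k] S) :
    WittVector p R →ₐ[WittVector p k] WittVector p S where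
  __ := WittVector.map (p := p) (f : R →+* S)
  commutes' w := by
    change WittVector.map (f : R →+* S) (WittVector.map (algebraMap k R) w) =
      WittVector.map (algebraMap k S) w
    ext i
    simp [WittVector.map_coeff]

/-- The `q`-power Frobenius `x ↦ x^q` of an algebra `R` over a finite field with `q` elements. -/
def frobHom (k R : Type u) [Field k] [Finite k] [CommRing R] [Algebra k R] : R →ₐ[k] R :=
  letI := Fintype.ofFinite k
  FiniteField.frobeniusAlgHom k R

lemma frobHom_apply (k R : Type u) [Field k] [Finite k] [CommRing R] [Algebra k R] (x : R) :
    frobHom k R x = x ^ Nat.card k := by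
  let := Fintype.ofFinite k
  rw [Nat.card_eq_fintype_card]
  rfl

/-! ### The ring schemes `R ↦ 𝕆_{K,h}(R)` -/

section Greenberg

variable (p : ℕ) [Fact p.Prime] (O : Type u) [CommRing O] [IsLocalRing O]
  [CharP (ResidueField O) p] [Finite (ResidueField O)] [IsAdicComplete (maximalIdeal O) O]

section Ring

variable (R : Type u) [CommRing R] [Algebra (ResidueField O) R]

/-- The ring `O ⊗_{W(k)} W(R)`. -/
abbrev Big : Type u := O ⊗[WittVector p (ResidueField O)] WittVector p R

/-- The ideal of `O ⊗_{W(k)} W(R)` generated by the elements `a ⊗ Vˢ w` with `pˢ a ∈ 𝔪ʰ`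
(`V` is the Verschiebung). If `R` is perfect, then `Vˢ W(R) = pˢ W(R)`, and this is the ideal
generated by `𝔪ʰ`. -/
def fil (h : ℕ) : Ideal (Big p O R) :=
  Ideal.span {x | ∃ (a : O) (s : ℕ) (w : WittVector p R),
    (p : O) ^ s * a ∈ maximalIdeal O ^ h ∧ x = a ⊗ₜ (WittVector.verschiebung^[s] w)}

/-- The ring `𝕆_{K,h}(R)` of `R`-points of the Greenberg realization of `O/𝔪ʰ`. It is
`O/𝔪ʰ ⊗_{W(k)} W(R)` for perfect `R`, and for all `R` it is the value of the fpqc sheaf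
associated with this functor. In equal characteristic it is `R[π]/(πʰ)`; for `O = W(k)` it is
the ring `W_h(R)` of truncated Witt vectors. -/
abbrev OK (h : ℕ) : Type u := Big p O R ⧸ fil p O R h

variable {R}

lemma fil_anti {i j : ℕ} (hij : i ≤ j) : fil p O R j ≤ fil p O R i := by
  refine Ideal.span_mono ?_
  rintro x ⟨a, s, w, ha, rfl⟩
  exact ⟨a, s, w, Ideal.pow_le_pow_right hij ha, rfl⟩

lemma algebraMap_mem_fil {h : ℕ} {a : O} (ha : a ∈ maximalIdeal O ^ h) :
    algebraMap O (Big p O R) a ∈ fil p O R h :=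
  Ideal.subset_span ⟨a, 0, 1, by simpa using ha, rfl⟩

variable {S T : Type u} [CommRing S] [Algebra (ResidueField O) S]
  [CommRing T] [Algebra (ResidueField O) T]

/-- Functoriality of `O ⊗_{W(k)} W(R)` in `R`. -/
def bigMap (f : R →ₐ[ResidueField O] S) : Big p O R →ₐ[O] Big p O S :=
  Algebra.TensorProduct.map (AlgHom.id O O) (wittMap p f)

lemma bigMap_comp (g : S →ₐ[ResidueField O] T) (f : R →ₐ[ResidueField O] S) (x : Big p O R) :
    bigMap p O g (bigMap p O f x) = bigMap p O (g.comp f) x := by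
  induction x using TensorProduct.induction_on with
  | zero => simp
  | add x y hx hy => simp only [map_add, hx, hy]
  | tmul a w =>
    simp only [bigMap, Algebra.TensorProduct.map_tmul]
    congr 1

lemma bigMap_id (x : Big p O R) : bigMap p O (AlgHom.id (ResidueField O) R) x = x := by
  induction x using TensorProduct.induction_on with
  | zero => simp
  | add x y hx hy => simp only [map_add, hx, hy]
  | tmul a w =>
    simp only [bigMap, Algebra.TensorProduct.map_tmul]
    congr 1

lemma fil_le_comap (f : R →ₐ[ResidueField O] S) (h : ℕ) :
    fil p O R h ≤ (fil p O S h).comap (bigMap p O f) := by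
  refine Ideal.span_le.mpr ?_
  rintro x ⟨a, s, w, ha, rfl⟩
  refine Ideal.subset_span ⟨a, s, WittVector.map (f : R →+* S) w, ha, ?_⟩
  simp only [bigMap]
  have hV : ∀ s : ℕ, WittVector.map (f : R →+* S) (WittVector.verschiebung^[s] w) =
      WittVector.verschiebung^[s] (WittVector.map (f : R →+* S) w) := by
    intro s
    induction s with
    | zero => rfl
    | succ s ih =>
      rw [Function.iterate_succ_apply', Function.iterate_succ_apply',
        WittVector.map_verschiebung, ih]
  exact congrArg (fun v => a ⊗ₜ[WittVector p (ResidueField O)] v) (hV s)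

/-- Functoriality of `𝕆_{K,h}`. -/
def okMap (f : R →ₐ[ResidueField O] S) (h : ℕ) : OK p O R h →+* OK p O S h :=
  Ideal.quotientMap _ (bigMap p O f : Big p O R →+* Big p O S) (fil_le_comap p O f h)

/-- The reduction map `𝕆_{K,j} → 𝕆_{K,i}` for `i ≤ j`. -/
def okRed {i j : ℕ} (hij : i ≤ j) : OK p O R j →+* OK p O R i :=
  Ideal.Quotient.factor (fil_anti p O hij)

/-- The Frobenius `φ` of `O ⊗_{W(k)} W(R)`, induced by the `q`-power Frobenius of `R`. -/
def bigFrob : Big p O R →ₐ[O] Big p O R := bigMap p O (frobHom (ResidueField O) R)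

lemma bigFrob_bigMap (f : R →ₐ[ResidueField O] S) (x : Big p O R) :
    bigFrob p O (bigMap p O f x) = bigMap p O f (bigFrob p O x) := by
  have h : (frobHom (ResidueField O) S).comp f = f.comp (frobHom (ResidueField O) R) := by
    ext y
    simp [frobHom_apply]
  rw [bigFrob, bigFrob, bigMap_comp, bigMap_comp, h]

lemma bigFrob_iterate (x : Big p O R) (i : ℕ) :
    (bigFrob p O)^[i] x = bigMap p O (frobHom (ResidueField O) R ^ i) x := by
  induction i generalizing x with
  | zero => exact (bigMap_id p O x).symm
  | succ i ih => rw [Function.iterate_succ_apply, ih, bigFrob, bigMap_comp]; rfl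

end Ring

/-! ### The functors of points of the schemes `X̃^{(m)}_h` -/

variable (ϖ : O) (n : ℕ) (m : ℤ)

section Points

variable {p O} in
/-- The `n × n` matrix with rows and columns indexed by `0, …, n-1` whose `(i,j)` entry is
`φⁱ(a_{m+j-i})` for `i ≤ j` and `π φⁱ(a_{m+j-i})` for `i > j`, indices of `a` being taken
modulo `n`. -/
def lusztigMatrix {R : Type u} [CommRing R] [Algebra (ResidueField O) R]
    (a : ZMod n → Big p O R) : Matrix (Fin n) (Fin n) (Big p O R) :=
  Matrix.of fun i j => (if j < i then algebraMap O (Big p O R) ϖ else 1) *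
    (bigFrob p O)^[(i : ℕ)] (a ((m + (j : ℕ) - (i : ℕ) : ℤ) : ZMod n))

/-- The truncation level of the coordinate `a_l`: it is `h` for `l ≡ m` and `h - 1` otherwise. -/
def level (h : ℕ) (l : ZMod n) : ℕ := if l = (m : ZMod n) then h else h - 1

lemma level_mono {i j : ℕ} (hij : i ≤ j) (l : ZMod n) : level n m i l ≤ level n m j l := by
  unfold level
  split_ifs <;> omega

lemma level_le (h : ℕ) (l : ZMod n) : level n m h l ≤ h := by
  unfold level
  split_ifs <;> omega

/-- The `R`-points of `X̃^{(m)}_h`.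

For `m = 0` these are the tuples `a_0 ∈ 𝕆_{K,h}(R)ˣ`, `a_1, …, a_{n-1} ∈ 𝕆_{K,h-1}(R)` such that
the determinant of the matrix with `(i,j)` entry `φⁱ(a_{j-i})` for `i ≤ j` and
`π φⁱ(a_{n+j-i})` for `i > j`, which is a well-defined element of `𝕆_{K,h}(R)`, is fixed by `φ`.

For arbitrary `m`, the set `X̃^{(m)}` consists of the matrices `A = X ϖᵐ` with `X` in `X̃^{(0)}`;
here `ϖ` is the matrix with `1` on the superdiagonal, `π` in the lower left corner and `0`
elsewhere. The first row of `A` is `(π^{t_0} a_0, …, π^{t_{n-1}} a_{n-1})` with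
`t_l = ⌈(m - l)/n⌉`, and the first row of `X = A ϖ⁻ᵐ` is `(a_m, a_{m+1}, …, a_{m+n-1})` (indices
modulo `n`). A point of `X̃^{(m)}_h` is such a tuple `a`, with `a_m` a unit of `𝕆_{K,h}(R)`, the
other `a_l` in `𝕆_{K,h-1}(R)`, and with `det (A ϖ⁻ᵐ) ∈ 𝕆_{K,h}(R)` fixed by `φ`. -/
@[ext]
structure Point (h : ℕ) (R : Type u) [CommRing R] [Algebra (ResidueField O) R] where
  coord : ∀ l : ZMod n, OK p O R (level n m h l)
  isUnit_coord : IsUnit (coord (m : ZMod n))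
  frob_det : ∃ a : ZMod n → Big p O R, (∀ l, Ideal.Quotient.mk _ (a l) = coord l) ∧
    bigFrob p O (lusztigMatrix ϖ n m a).det - (lusztigMatrix ϖ n m a).det ∈ fil p O R h

variable {p O ϖ n m} {h : ℕ} {R S : Type u} [CommRing R] [Algebra (ResidueField O) R]
  [CommRing S] [Algebra (ResidueField O) S]

lemma lusztigMatrix_map (f : R →ₐ[ResidueField O] S) (a : ZMod n → Big p O R) :
    lusztigMatrix ϖ n m (fun l => bigMap p O f (a l)) =
      (lusztigMatrix ϖ n m a).map (bigMap p O f) := by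
  have hit : ∀ (i : ℕ) (x : Big p O R),
      (bigFrob p O)^[i] (bigMap p O f x) = bigMap p O f ((bigFrob p O)^[i] x) := by
    intro i
    induction i with
    | zero => intro x; rfl
    | succ i ih =>
      intro x
      rw [Function.iterate_succ_apply, Function.iterate_succ_apply, bigFrob_bigMap, ih]
  ext i j
  simp only [lusztigMatrix, Matrix.of_apply, Matrix.map_apply, map_mul, hit]
  congr 1
  split_ifs
  · exact ((bigMap p O f).commutes ϖ).symm
  · exact (map_one _).symm

lemma bigFrob_iterate_mem {j : ℕ} {x : Big p O R} (hx : x ∈ fil p O R j) (i : ℕ) :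
    (bigFrob p O)^[i] x ∈ fil p O R j := by
  rw [bigFrob_iterate]
  exact fil_le_comap p O _ j hx

lemma unif_mul_mem_fil (hϖ : ϖ ∈ maximalIdeal O) {x : Big p O R} (hx : x ∈ fil p O R (h - 1)) :
    algebraMap O (Big p O R) ϖ * x ∈ fil p O R h := by
  have hle : fil p O R (h - 1) ≤
      Submodule.comap (LinearMap.lsmul (Big p O R) (Big p O R) (algebraMap O (Big p O R) ϖ))
        (fil p O R h) := by
    refine Ideal.span_le.mpr ?_
    rintro x ⟨a, s, w, ha, rfl⟩
    refine Ideal.subset_span ⟨ϖ * a, s, w, ?_, ?_⟩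
    · have h1 : ϖ * ((p : O) ^ s * a) ∈ maximalIdeal O * maximalIdeal O ^ (h - 1) :=
        Ideal.mul_mem_mul hϖ ha
      rw [← pow_succ'] at h1
      rw [mul_left_comm]
      exact Ideal.pow_le_pow_right (by omega) h1
    · simp [Algebra.TensorProduct.tmul_mul_tmul]
  exact hle hx

/-- The determinant in `𝕆_{K,h}(R)` does not depend on the lifts of the coordinates. -/
lemma det_lusztigMatrix_sub_mem (hϖ : ϖ ∈ maximalIdeal O) (a b : ZMod n → Big p O R)
    (hab : ∀ l, a l - b l ∈ fil p O R (level n m h l)) :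
    (lusztigMatrix ϖ n m a).det - (lusztigMatrix ϖ n m b).det ∈ fil p O R h := by
  have hfrob : ∀ (i j : ℕ) (l : ZMod n), j ≤ level n m h l →
      (bigFrob p O)^[i] (a l) - (bigFrob p O)^[i] (b l) ∈ fil p O R j := by
    intro i j l hj
    have h1 := bigFrob_iterate_mem (fil_anti p O hj (hab l)) i
    rw [bigFrob_iterate, map_sub, ← bigFrob_iterate, ← bigFrob_iterate] at h1
    exact h1
  rw [Matrix.det_apply, Matrix.det_apply, ← Finset.sum_sub_distrib]
  refine Ideal.sum_mem _ fun σ _ => ?_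
  rw [← smul_sub]
  suffices hmem : (∏ i, lusztigMatrix ϖ n m a (σ i) i) - ∏ i, lusztigMatrix ϖ n m b (σ i) i ∈
      fil p O R h by
    rcases Int.units_eq_one_or (Equiv.Perm.sign σ) with hs | hs <;> rw [hs]
    · simpa using hmem
    · simpa [Units.neg_smul] using neg_mem hmem
  by_cases hσ : ∃ i, i < σ i
  · obtain ⟨i₀, hi₀⟩ := hσ
    simp only [lusztigMatrix, Matrix.of_apply, Finset.prod_mul_distrib]
    rw [← mul_sub]
    have hdvd : algebraMap O (Big p O R) ϖ ∣
        ∏ i : Fin n, (if i < σ i then algebraMap O (Big p O R) ϖ else 1) := by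
      have h1 := Finset.dvd_prod_of_mem
        (fun i : Fin n => if i < σ i then algebraMap O (Big p O R) ϖ else 1) (Finset.mem_univ i₀)
      simpa only [if_pos hi₀] using h1
    obtain ⟨d, hd⟩ := hdvd
    rw [hd, mul_comm _ d, mul_assoc]
    refine Ideal.mul_mem_left _ _ (unif_mul_mem_fil hϖ ?_)
    rw [← Ideal.Quotient.eq, map_prod, map_prod]
    refine Finset.prod_congr rfl fun i _ => Ideal.Quotient.eq.mpr (hfrob _ _ _ ?_)
    unfold level
    split_ifs <;> omega
  · have hle : ∀ i, σ i ≤ i := fun i => not_lt.mp fun hi => hσ ⟨i, hi⟩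
    have hsum : ∑ i : Fin n, ((σ i : Fin n) : ℕ) = ∑ i : Fin n, (i : ℕ) :=
      Equiv.sum_comp σ (fun i : Fin n => (i : ℕ))
    have heq := (Finset.sum_eq_sum_iff_of_le (fun i _ => Fin.le_def.mp (hle i))).mp hsum
    have hid : ∀ i, σ i = i := fun i => Fin.ext (heq i (Finset.mem_univ i))
    rw [← Ideal.Quotient.eq, map_prod, map_prod]
    refine Finset.prod_congr rfl fun i _ => ?_
    simp only [hid, lusztigMatrix, Matrix.of_apply, lt_irrefl, if_false, one_mul,
      add_sub_cancel_right]
    exact Ideal.Quotient.eq.mpr (hfrob _ _ _ (by simp [level]))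

/-- Functoriality of the set of points of `X̃^{(m)}_h`. -/
def Point.map (f : R →ₐ[ResidueField O] S) (x : Point p O ϖ n m h R) : Point p O ϖ n m h S where
  coord l := okMap p O f _ (x.coord l)
  isUnit_coord := x.isUnit_coord.map _
  frob_det := by
    obtain ⟨a, ha, hdet⟩ := x.frob_det
    refine ⟨fun l => bigMap p O f (a l), fun l => ?_, ?_⟩
    · rw [← ha l]
      rfl
    · have h1 : (lusztigMatrix ϖ n m (fun l => bigMap p O f (a l))).det =
          bigMap p O f (lusztigMatrix ϖ n m a).det := by
        rw [lusztigMatrix_map]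
        exact (AlgHom.map_det (bigMap p O f) (lusztigMatrix ϖ n m a)).symm
      rw [h1, bigFrob_bigMap, ← map_sub]
      exact fil_le_comap p O f h hdet

/-- The reduction map `X̃^{(m)}_j → X̃^{(m)}_i` for `i ≤ j`. -/
def Point.red {i j : ℕ} (hij : i ≤ j) (x : Point p O ϖ n m j R) : Point p O ϖ n m i R where
  coord l := okRed p O (level_mono n m hij l) (x.coord l)
  isUnit_coord := x.isUnit_coord.map _
  frob_det := by
    obtain ⟨a, ha, hdet⟩ := x.frob_det
    refine ⟨a, fun l => ?_, fil_anti p O hij hdet⟩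
    rw [← ha l]
    rfl

end Points

/-! ### The groups `Z_h` and `W_h` and their action -/

section Action

variable (Ω : Type u) [Field Ω] [Algebra (ResidueField O) Ω]

/-- The subfield `𝔽_{qⁿ} = {x | x^{qⁿ} = x}` of an algebraic closure `Ω` of `𝔽_q`. -/
def Fqn : Subalgebra (ResidueField O) Ω :=
  AlgHom.equalizer (frobHom (ResidueField O) Ω ^ n) (AlgHom.id (ResidueField O) Ω)

/-- The ring of integers `O_L = O ⊗_{W(𝔽_q)} W(𝔽_{qⁿ})` of the unramified extension `L` of
degree `n` of the local field `K` with ring of integers `O`. -/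
abbrev OL : Type u := Big p O (Fqn O n Ω)

/-- The group `Z_h = (O_L / πʰ O_L)ˣ`. -/
abbrev Z (h : ℕ) : Type u := (OL p O n Ω ⧸ Ideal.span {algebraMap O (OL p O n Ω) ϖ ^ h})ˣ

/-- The reduction map `Z_j → Z_i` for `i ≤ j`. -/
def zRed {i j : ℕ} (hij : i ≤ j) : Z p O ϖ n Ω j →* Z p O ϖ n Ω i :=
  Units.map (Ideal.Quotient.factor
    (Ideal.span_singleton_le_span_singleton.mpr (pow_dvd_pow _ hij)) :
      (OL p O n Ω ⧸ Ideal.span {algebraMap O (OL p O n Ω) ϖ ^ j}) →+*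
        (OL p O n Ω ⧸ Ideal.span {algebraMap O (OL p O n Ω) ϖ ^ i})).toMonoidHom

/-- `W_h = Ker (Z_h → Z_{h-1})`. -/
def W (h : ℕ) : Subgroup (Z p O ϖ n Ω h) := (zRed p O ϖ n Ω (Nat.sub_le h 1)).ker

variable {Ω} {R : Type u} [CommRing R] [Algebra (ResidueField O) R] [Algebra Ω R]
  [IsScalarTower (ResidueField O) Ω R]

variable (R) in
/-- The inclusion `𝔽_{qⁿ} ⊆ Ω → R`. -/
def fqnTo : Fqn O n Ω →ₐ[ResidueField O] R :=
  (IsScalarTower.toAlgHom (ResidueField O) Ω R).comp (Fqn O n Ω).val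

variable {p O ϖ n m}

lemma bigFrob_iterate_OL (z : OL p O n Ω) : (bigFrob p O)^[n] z = z := by
  rw [bigFrob_iterate]
  have h : frobHom (ResidueField O) (Fqn O n Ω) ^ n = AlgHom.id (ResidueField O) (Fqn O n Ω) := by
    have hpow : ∀ (i : ℕ) (x : Fqn O n Ω),
        (((frobHom (ResidueField O) (Fqn O n Ω) ^ i) x : Fqn O n Ω) : Ω) =
          (frobHom (ResidueField O) Ω ^ i) (x : Ω) := by
      intro i
      induction i with
      | zero => intro x; rfl
      | succ i ih =>
        intro x
        rw [pow_succ, pow_succ, AlgHom.mul_apply, AlgHom.mul_apply, ih]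
        congr 1
    ext x
    rw [hpow]
    exact x.2
  rw [h, bigMap_id]

lemma prod_bigFrob [NeZero n] (z : Big p O R) (hz : (bigFrob p O)^[n] z = z) :
    bigFrob p O (∏ i : Fin n, (bigFrob p O)^[(i : ℕ)] z) =
      ∏ i : Fin n, (bigFrob p O)^[(i : ℕ)] z := by
  obtain ⟨k, rfl⟩ := Nat.exists_eq_succ_of_ne_zero (NeZero.ne n)
  rw [Fin.prod_univ_eq_prod_range (fun i => (bigFrob p O)^[i] z), map_prod]
  simp only [← Function.iterate_succ_apply' (bigFrob p O)]
  rw [Finset.prod_range_succ, Finset.prod_range_succ', hz]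
  rfl

/-- The ring homomorphism `O_L / πʰ → 𝕆_{K,j}(R)` for `j ≤ h`. -/
def olTo (hϖ : ϖ ∈ maximalIdeal O) {h j : ℕ} (hj : j ≤ h) :
    (OL p O n Ω ⧸ Ideal.span {algebraMap O (OL p O n Ω) ϖ ^ h}) →+* OK p O R j :=
  Ideal.quotientMap _ (bigMap p O (fqnTo O n (Ω := Ω) R) : OL p O n Ω →+* Big p O R) (by
    rw [Ideal.span_singleton_le_iff_mem, Ideal.mem_comap, ← map_pow]
    have h1 : (bigMap p O (fqnTo O n (Ω := Ω) R) : OL p O n Ω →+* Big p O R)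
        (algebraMap O (OL p O n Ω) (ϖ ^ h)) = algebraMap O (Big p O R) (ϖ ^ h) :=
      (bigMap p O (fqnTo O n (Ω := Ω) R)).commutes _
    rw [h1]
    exact fil_anti p O hj (algebraMap_mem_fil p O (Ideal.pow_mem_pow hϖ h)))

/-- The action of `Z_h` on `X̃^{(m)}_h` by left multiplication: `z` multiplies a matrix on the left
by `diag(z, φ(z), …, φⁿ⁻¹(z))`, that is, it multiplies each `a_l` by `z`. -/
def Point.act [NeZero n] (hϖ : ϖ ∈ maximalIdeal O) {h : ℕ} (z : Z p O ϖ n Ω h) (x : Point p O ϖ n m h R) :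
    Point p O ϖ n m h R where
  coord l := olTo (R := R) (Ω := Ω) (n := n) hϖ (level_le n m h l) z.val * x.coord l
  isUnit_coord := (z.isUnit.map _).mul x.isUnit_coord
  frob_det := by
    obtain ⟨a, ha, hdet⟩ := x.frob_det
    obtain ⟨y, hy⟩ := Ideal.Quotient.mk_surjective z.val
    refine ⟨fun l => bigMap p O (fqnTo O n (Ω := Ω) R) y * a l, fun l => ?_, ?_⟩
    · rw [← ha l, ← hy, map_mul]
      rfl
    · have hit : ∀ (i : ℕ) (u v : Big p O R), (bigFrob p O)^[i] (u * v) =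
          (bigFrob p O)^[i] u * (bigFrob p O)^[i] v := by
        intro i u v
        rw [bigFrob_iterate, bigFrob_iterate, bigFrob_iterate, map_mul]
      have hit' : ∀ (i : ℕ) (u : OL p O n Ω), (bigFrob p O)^[i] (bigMap p O (fqnTo O n (Ω := Ω) R) u) =
          bigMap p O (fqnTo O n (Ω := Ω) R) ((bigFrob p O)^[i] u) := by
        intro i
        induction i with
        | zero => intro x; rfl
        | succ i ih =>
          intro x
          rw [Function.iterate_succ_apply, Function.iterate_succ_apply, bigFrob_bigMap, ih]
      have h1 : lusztigMatrix ϖ n m (fun l => bigMap p O (fqnTo O n (Ω := Ω) R) y * a l) =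
          Matrix.of fun i j : Fin n => (bigFrob p O)^[(i : ℕ)] (bigMap p O (fqnTo O n (Ω := Ω) R) y) *
            lusztigMatrix ϖ n m a i j := by
        ext i j
        simp only [lusztigMatrix, Matrix.of_apply, hit]
        ring
      rw [h1, Matrix.det_mul_column, map_mul,
        prod_bigFrob _ (by rw [hit', bigFrob_iterate_OL]), ← mul_sub]
      exact Ideal.mul_mem_left _ _ hdet

end Action

/-! ### The schemes `X̃^{(m)}_h` over `Ω = 𝔽̄_q` and the quotients `W_h \ X̃^{(m)}_h` -/

section Schemes

variable (Ω : Type u) [Field Ω] [Algebra (ResidueField O) Ω]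

/-- An `Ω`-algebra `carrier` representing the functor `X̃^{(m)}_h` on `Ω`-algebras, that is, a
coordinate ring of the affine `Ω`-scheme `X̃^{(m)}_h`, together with the universal point. -/
structure CoordRing (h : ℕ) where
  carrier : Type u
  [commRing : CommRing carrier]
  [algebraRes : Algebra (ResidueField O) carrier]
  [algebra : Algebra Ω carrier]
  [tower : IsScalarTower (ResidueField O) Ω carrier]
  point : Point p O ϖ n m h carrier
  universal : ∀ (R : Type u) [CommRing R] [Algebra (ResidueField O) R] [Algebra Ω R]
    [IsScalarTower (ResidueField O) Ω R],
    Function.Bijective fun f : carrier →ₐ[Ω] R => point.map (f.restrictScalars (ResidueField O))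

attribute [instance] CoordRing.commRing CoordRing.algebraRes CoordRing.algebra CoordRing.tower

namespace CoordRing

variable {p O ϖ n m Ω} {h : ℕ} [NeZero n]

/-- The homomorphism from the coordinate ring to `R` that corresponds to an `R`-point. -/
def ofPoint (X : CoordRing p O ϖ n m Ω h) {R : Type u} [CommRing R] [Algebra (ResidueField O) R]
    [Algebra Ω R] [IsScalarTower (ResidueField O) Ω R] (x : Point p O ϖ n m h R) :
    X.carrier →ₐ[Ω] R :=
  ((X.universal R).2 x).choose

lemma map_ofPoint (X : CoordRing p O ϖ n m Ω h) {R : Type u} [CommRing R]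
    [Algebra (ResidueField O) R] [Algebra Ω R] [IsScalarTower (ResidueField O) Ω R]
    (x : Point p O ϖ n m h R) :
    X.point.map ((X.ofPoint x).restrictScalars (ResidueField O)) = x :=
  ((X.universal R).2 x).choose_spec

/-- The scheme `X̃^{(m)}_h` over `Ω`. -/
def scheme (X : CoordRing p O ϖ n m Ω h) : Scheme.{u} := Spec (.of X.carrier)

/-- The automorphism of the coordinate ring by which `z ∈ Z_h` acts. -/
def actHom (X : CoordRing p O ϖ n m Ω h) (hϖ : ϖ ∈ maximalIdeal O) (z : Z p O ϖ n Ω h) :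
    X.carrier →ₐ[Ω] X.carrier :=
  X.ofPoint (X.point.act hϖ z)

/-- The action of `z ∈ Z_h` on the scheme `X̃^{(m)}_h`. -/
def act (X : CoordRing p O ϖ n m Ω h) (hϖ : ϖ ∈ maximalIdeal O) (z : Z p O ϖ n Ω h) :
    X.scheme ⟶ X.scheme :=
  Spec.map (CommRingCat.ofHom (X.actHom hϖ z).toRingHom)

/-- The natural morphism `X̃^{(m)}_j → X̃^{(m)}_i` for `i ≤ j`. -/
def trans {i j : ℕ} (hij : i ≤ j) (X : CoordRing p O ϖ n m Ω j) (Y : CoordRing p O ϖ n m Ω i) :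
    X.scheme ⟶ Y.scheme :=
  Spec.map (CommRingCat.ofHom (Y.ofPoint (X.point.red hij)).toRingHom)

/-- The ring of invariants of `W_h` in the coordinate ring of `X̃^{(m)}_h`. -/
def invariants (X : CoordRing p O ϖ n m Ω h) (hϖ : ϖ ∈ maximalIdeal O) : Subalgebra Ω X.carrier :=
  ⨅ w ∈ W p O ϖ n Ω h, AlgHom.equalizer (X.actHom hϖ w) (AlgHom.id Ω X.carrier)

/-- The quotient `W_h \ X̃^{(m)}_h` of the affine scheme `X̃^{(m)}_h` by the finite group `W_h`. -/
def quot (X : CoordRing p O ϖ n m Ω h) (hϖ : ϖ ∈ maximalIdeal O) : Scheme.{u} :=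
  Spec (.of (X.invariants hϖ))

/-- The quotient morphism `X̃^{(m)}_h → W_h \ X̃^{(m)}_h`. -/
def toQuot (X : CoordRing p O ϖ n m Ω h) (hϖ : ϖ ∈ maximalIdeal O) : X.scheme ⟶ X.quot hϖ :=
  Spec.map (CommRingCat.ofHom (X.invariants hϖ).val.toRingHom)

end CoordRing

end Schemes

end Greenberg

section LocalField

variable (K : Type u) [Field K] [ValuativeRel K] [TopologicalSpace K]
  [IsNonarchimedeanLocalField K]

instance isAdicComplete_integer : IsAdicComplete (maximalIdeal 𝒪[K]) 𝒪[K] := by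
  let := IsTopologicalAddGroup.rightUniformSpace K
  have := isUniformAddGroup_of_addCommGroup (G := K)
  infer_instance

instance finite_residueField_integer : Finite (ResidueField 𝒪[K]) :=
  inferInstanceAs (Finite 𝓀[K])

end LocalField

end

end DivisionLusztig

open DivisionLusztig CategoryTheory CategoryTheory.Limits AlgebraicGeometry IsLocalRing

/-! Filter `Big p O R` by the ideals `fil p O R h`. The quotient of `fil h` by `fil (h + 1)` is a
copy of `R`: if `s` is maximal with `p ^ s ∣ ϖ ^ h` and `c = ϖ ^ h / p ^ s`, then `x ↦ c ⊗ V^s [x]`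
(`lead`) is a bijection onto it (`exists_lead`, `lead_injective`). Leading coefficients add, become
`q`-th powers under `φ`, and a factor `b` multiplies them by `res b ^ p ^ s`. This holds for every
`R`, perfect or not, and in both characteristics.

Passing from a point of level `h` to one of level `h + 1` means choosing one more leading
coefficient for each coordinate: `y_l` for the `n - 1` indices `l ≠ m` (`shift`), and `t` for `l =
m`, introduced through a factor `1 + lead t` (`twist`). Off-diagonal terms of the determinant carry
a factor `ϖ`, so `t` enters only through the diagonal product and changes the determinant by `N ^ p
^ s * (t + t^q + ⋯ + t^(q^(n-1)))` to leading order, where `N` is the residue of the determinant.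
Since `N ^ q = N`, the sum telescopes and the condition `φ(det) = det` becomes `t ^ q ^ n - t + f =
0`, with `f` a function on `X̃_h × 𝔸ⁿ⁻¹` (`coverLift_frob_iff`). Lifts of the coordinates of the
universal point exist globally because `OK` is a quotient of `Big`, so the construction needs no
localization. Thus `X̃_{h+1}` is the cover of `X̃_h × 𝔸ⁿ⁻¹` given by this equation
(`CoordRing.succ`). Induction from `X̃_1`, the scheme of roots of unity of order `q ^ n - 1`, gives
existence and finite type.

The element `1 + ϖ ^ h y` of `W_{h+1}` fixes the functions on `X̃_h × 𝔸ⁿ⁻¹` and translates `t` by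
`res y ^ p ^ s` (`succ_actHom`). These translations exhaust `𝔽_{qⁿ}`, and a polynomial in `t` of
degree below `q ^ n` that is invariant under all of them is constant
(`mem_range_of_of_translation`). Hence the invariants are exactly the functions on `X̃_h × 𝔸ⁿ⁻¹`;
smoothness and the description of the fibers follow. -/

namespace DivisionLusztig

noncomputable section

open IsLocalRing CategoryTheory AlgebraicGeometry IsAdicComplete

/-! ### Self-injectivity of truncations of a discrete valuation ring -/

/-- A proper quotient of a discrete valuation ring by a power of a uniformizer is self-injective. -/
lemma baer_quotient_pow {A : Type u} [CommRing A] [IsDomain A] [IsDiscreteValuationRing A]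
    {π : A} (hπ : Irreducible π) (s : ℕ) :
    Module.Baer (A ⧸ Ideal.span {π ^ s}) (A ⧸ Ideal.span {π ^ s}) := by
  intro I g
  set mk := Ideal.Quotient.mk (Ideal.span {π ^ s})
  have hmk : ∀ a, mk a = 0 ↔ π ^ s ∣ a := fun a => by
    rw [Ideal.Quotient.eq_zero_iff_mem, Ideal.mem_span_singleton]
  have : IsPrincipalIdealRing (A ⧸ Ideal.span {π ^ s}) :=
    IsPrincipalIdealRing.of_surjective mk Ideal.Quotient.mk_surjective
  obtain ⟨d, rfl⟩ := (IsPrincipalIdealRing.principal I).principal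
  obtain ⟨D, rfl⟩ := Ideal.Quotient.mk_surjective d
  -- Every ideal is principal, so it suffices to divide `g(D)` by the generator `D`. For `D = ε π ^
  -- j` the value `g(D)` is killed by `π ^ (s - j)`, hence is divisible by `π ^ j`.
  have key : ∃ y, y * mk D = g ⟨mk D, Submodule.mem_span_singleton_self _⟩ := by
    by_cases hD : mk D = 0
    · refine ⟨0, ?_⟩
      have : (⟨mk D, Submodule.mem_span_singleton_self _⟩ :
          Submodule.span (A ⧸ Ideal.span {π ^ s}) {mk D}) = 0 := Subtype.ext hD
      rw [zero_mul, this, map_zero]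
    · have hD0 : D ≠ 0 := fun h => hD (by rw [h, map_zero])
      obtain ⟨j, ε, rfl⟩ := IsDiscreteValuationRing.eq_unit_mul_pow_irreducible hD0 hπ
      have hj : j < s := by
        by_contra hj
        exact hD ((hmk _).2 (Dvd.dvd.mul_left (pow_dvd_pow _ (not_lt.mp hj)) _))
      obtain ⟨Y, hY⟩ := Ideal.Quotient.mk_surjective
        (g ⟨mk (ε * π ^ j), Submodule.mem_span_singleton_self _⟩)
      have h0 : mk (π ^ (s - j)) * mk Y = 0 := by
        rw [show mk Y = _ from hY, ← smul_eq_mul, ← map_smul]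
        have : (mk (π ^ (s - j)) • (⟨mk (ε * π ^ j), Submodule.mem_span_singleton_self _⟩ :
          Submodule.span (A ⧸ Ideal.span {π ^ s}) {mk (ε * π ^ j)})) = 0 := by
          refine Subtype.ext ?_
          change mk (π ^ (s - j)) * mk (ε * π ^ j) = 0
          rw [← map_mul, hmk]
          refine ⟨ε, ?_⟩
          rw [mul_left_comm, ← pow_add, Nat.sub_add_cancel hj.le, mul_comm]
        rw [this, map_zero]
      rw [← map_mul, hmk] at h0
      obtain ⟨c, hc⟩ := h0
      have hY' : Y = π ^ j * c := by
        apply mul_left_cancel₀ (pow_ne_zero (s - j) hπ.ne_zero)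
        rw [hc, ← mul_assoc, ← pow_add, Nat.sub_add_cancel hj.le]
      refine ⟨mk (c * (ε⁻¹ : Aˣ)), ?_⟩
      rw [← hY, ← map_mul, hY']
      congr 1
      rw [mul_assoc, Units.inv_mul_cancel_left, mul_comm]
  obtain ⟨y, hy⟩ := key
  refine ⟨LinearMap.mulLeft _ y, fun x hx => ?_⟩
  obtain ⟨a, rfl⟩ := Submodule.mem_span_singleton.mp hx
  have : (⟨a • mk D, hx⟩ : Submodule.span (A ⧸ Ideal.span {π ^ s}) {mk D}) =
      a • ⟨mk D, Submodule.mem_span_singleton_self _⟩ := rfl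
  rw [this, g.map_smul, ← hy]
  simp only [LinearMap.mulLeft_apply, smul_eq_mul]
  ring

/-! ### Powers of `p` dividing `ϖ ^ h` -/

section Valuation

variable {O : Type u} [CommRing O] [IsDomain O] [IsDiscreteValuationRing O] {ϖ : O}

lemma mem_maximalIdeal_pow (hϖ : Irreducible ϖ) {h : ℕ} {a : O} :
    a ∈ maximalIdeal O ^ h ↔ ϖ ^ h ∣ a := by
  rw [(IsDiscreteValuationRing.irreducible_iff_uniformizer ϖ).1 hϖ, Ideal.span_singleton_pow,
    Ideal.mem_span_singleton]

/-- Writing `ϖ ^ h = p ^ s * c` with `s` maximal, the number `p ^ (s + 1)` is divisible by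
`ϖ ^ (h + 1)`. -/
lemma exists_pow_mul_eq (hϖ : Irreducible ϖ) {x : O} (hx : x ∈ maximalIdeal O) (h : ℕ) :
    ∃ (s : ℕ) (c : O), x ^ s * c = ϖ ^ h ∧ ϖ ^ (h + 1) ∣ x ^ (s + 1) := by
  classical
  -- Since `ϖ ^ s ∣ x ^ s`, only `s ≤ h` can occur, so the greatest `s` up to `h` is a true maximum.
  have hlt : ∀ s, h < s → ¬ x ^ s ∣ ϖ ^ h := fun s hs hd => by
    have h1 : ϖ ^ s ∣ ϖ ^ h :=
      ((mem_maximalIdeal_pow hϖ).1 (Ideal.pow_mem_pow hx s)).trans hd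
    exact absurd ((pow_dvd_pow_iff hϖ.ne_zero hϖ.not_isUnit).1 h1) (not_le.2 hs)
  set s := Nat.findGreatest (fun s => x ^ s ∣ ϖ ^ h) h
  have hs : x ^ s ∣ ϖ ^ h :=
    Nat.findGreatest_spec (P := fun s => x ^ s ∣ ϖ ^ h) (Nat.zero_le h) (by simp)
  have hs' : ¬ x ^ (s + 1) ∣ ϖ ^ h := by
    by_cases hh : s + 1 ≤ h
    · exact Nat.findGreatest_is_greatest (P := fun s => x ^ s ∣ ϖ ^ h) (Nat.lt_succ_self s) hh
    · exact hlt _ (not_le.1 hh)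
  obtain ⟨c, hc⟩ := hs
  refine ⟨s, c, hc.symm, ?_⟩
  -- The zero case is needed because `x` will be `p`, which vanishes in equal characteristic.
  by_cases h0 : x ^ (s + 1) = 0
  · rw [h0]; exact dvd_zero _
  · obtain ⟨j, ε, hj⟩ := IsDiscreteValuationRing.eq_unit_mul_pow_irreducible h0 hϖ
    rw [hj] at hs' ⊢
    rw [Units.mul_left_dvd, pow_dvd_pow_iff hϖ.ne_zero hϖ.not_isUnit] at hs'
    exact Dvd.dvd.mul_left (pow_dvd_pow _ (by omega)) _

variable (p : ℕ) [CharP (ResidueField O) p]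

variable (O) in
lemma natCast_mem_maximalIdeal : (p : O) ∈ maximalIdeal O := by
  rw [← residue_eq_zero_iff, map_natCast, CharP.cast_eq_zero]

/-- The largest `s` such that `p ^ s` divides `ϖ ^ h`. -/
def expo (hϖ : Irreducible ϖ) (h : ℕ) : ℕ :=
  (exists_pow_mul_eq hϖ (natCast_mem_maximalIdeal O p) h).choose

/-- The quotient of `ϖ ^ h` by the largest power of `p` that divides it. -/
def cofactor (hϖ : Irreducible ϖ) (h : ℕ) : O :=
  (exists_pow_mul_eq hϖ (natCast_mem_maximalIdeal O p) h).choose_spec.choose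

lemma pow_expo_mul_cofactor (hϖ : Irreducible ϖ) (h : ℕ) :
    (p : O) ^ expo p hϖ h * cofactor p hϖ h = ϖ ^ h :=
  (exists_pow_mul_eq hϖ (natCast_mem_maximalIdeal O p) h).choose_spec.choose_spec.1

lemma dvd_pow_expo_succ (hϖ : Irreducible ϖ) (h : ℕ) :
    ϖ ^ (h + 1) ∣ (p : O) ^ (expo p hϖ h + 1) :=
  (exists_pow_mul_eq hϖ (natCast_mem_maximalIdeal O p) h).choose_spec.choose_spec.2

variable [Fact p.Prime] [Finite (ResidueField O)] [IsAdicComplete (maximalIdeal O) O]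

/-- A `W(k)`-linear functional `O → W(k)/pˢ⁺¹` which is trivial on `𝔪ʰ⁺¹` and takes the value `1`
at the cofactor of `ϖ ^ h`. -/
lemma exists_functional (hϖ : Irreducible ϖ) (h : ℕ) :
    ∃ ℓ : O →+ WittVector p (ResidueField O) ⧸
        Ideal.span {(p : WittVector p (ResidueField O)) ^ (expo p hϖ h + 1)},
      (∀ b a, ℓ (wittHom p O b * a) = Ideal.Quotient.mk _ b * ℓ a) ∧
      (∀ a, ϖ ^ (h + 1) ∣ a → ℓ a = 0) ∧ ℓ (cofactor p hϖ h) = 1 := by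
  set s := expo p hϖ h
  set W := WittVector p (ResidueField O)
  have hp : Irreducible (p : W) := WittVector.irreducible p
  set Λ := W ⧸ Ideal.span {(p : W) ^ (s + 1)}
  set M := O ⧸ Ideal.span {ϖ ^ (h + 1)}
  let j : Λ →+* M := Ideal.quotientMap _ (wittHom p O) (by
    rw [Ideal.span_singleton_le_iff_mem, Ideal.mem_comap, map_pow, map_natCast,
      Ideal.mem_span_singleton]
    exact dvd_pow_expo_succ p hϖ h)
  have hj : ∀ b, j (Ideal.Quotient.mk _ b) = Ideal.Quotient.mk _ (wittHom p O b) := fun b => rfl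
  let _ : Module Λ M := Module.compHom M j
  have hsm : ∀ (b : Λ) (x : M), b • x = j b * x := fun b x => rfl
  let i : Λ →ₗ[Λ] M := LinearMap.toSpanSingleton Λ M (Ideal.Quotient.mk _ (cofactor p hϖ h))
  -- If `p ^ r * c` were divisible by `ϖ ^ (h + 1)` for some `r ≤ s`, so would be `p ^ s * c = ϖ ^
  -- h`.
  have hi : Function.Injective i := by
    rw [injective_iff_map_eq_zero]
    intro b hb
    obtain ⟨b, rfl⟩ := Ideal.Quotient.mk_surjective b
    rw [LinearMap.toSpanSingleton_apply, hsm, hj, ← map_mul, Ideal.Quotient.eq_zero_iff_mem,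
      Ideal.mem_span_singleton] at hb
    rw [Ideal.Quotient.eq_zero_iff_mem, Ideal.mem_span_singleton]
    by_cases hb0 : b = 0
    · rw [hb0]; exact dvd_zero _
    obtain ⟨r, ε, rfl⟩ := IsDiscreteValuationRing.eq_unit_mul_pow_irreducible hb0 hp
    refine Dvd.dvd.mul_left (pow_dvd_pow _ ?_) _
    by_contra hr
    have hr : r ≤ s := by omega
    rw [map_mul, map_pow, map_natCast, mul_assoc] at hb
    have hε : IsUnit (wittHom p O (ε : W)) := ε.isUnit.map _
    obtain ⟨ε', hε'⟩ := hε
    rw [← hε', Units.dvd_mul_left] at hb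
    have h1 : ϖ ^ (h + 1) ∣ ϖ ^ h := by
      rw [← pow_expo_mul_cofactor p hϖ h]
      change _ ∣ (p : O) ^ s * _
      rw [← Nat.sub_add_cancel hr, pow_add (p : O), mul_assoc]
      exact Dvd.dvd.mul_left hb _
    have := (pow_dvd_pow_iff hϖ.ne_zero hϖ.not_isUnit).1 h1
    omega
  -- Self-injectivity of `Λ` provides a retraction of the inclusion `Λ → M`, `1 ↦ c`.
  obtain ⟨g, hg⟩ := (baer_quotient_pow hp (s + 1)).extension_property i hi LinearMap.id
  refine ⟨g.toAddMonoidHom.comp (Ideal.Quotient.mk _).toAddMonoidHom, fun b a => ?_,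
    fun a ha => ?_, ?_⟩
  · change g (Ideal.Quotient.mk _ _) = _ * g (Ideal.Quotient.mk _ _)
    rw [map_mul, ← hj, ← hsm, map_smul, smul_eq_mul]
  · change g (Ideal.Quotient.mk _ _) = 0
    rw [Ideal.Quotient.eq_zero_iff_mem.2 (Ideal.mem_span_singleton.2 ha), map_zero]
  · change g (Ideal.Quotient.mk _ _) = 1
    have := LinearMap.congr_fun hg 1
    rw [LinearMap.comp_apply, LinearMap.toSpanSingleton_apply, one_smul] at this
    exact this

end Valuation

/-! ### Verschiebung and Teichmüller representatives in characteristic `p` -/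

section Witt

variable (p : ℕ) [Fact p.Prime] (k : Type u) [Field k] [CharP k p] {R : Type u} [CommRing R]
  [Algebra k R]

include k

omit [Fact p.Prime] in
lemma charP_of_nontrivial [Nontrivial R] : CharP R p :=
  charP_of_injective_algebraMap (algebraMap k R).injective p

/-- The identity for iterated Verschiebungs requires characteristic `p`, which the zero algebra does
not have; it is treated separately here and in the next two lemmas. -/
lemma iterate_verschiebung_mul_iterate (x y : WittVector p R) (i j : ℕ) :
    WittVector.verschiebung^[i] x * WittVector.verschiebung^[j] y =
      WittVector.verschiebung^[i + j]
        (WittVector.frobenius^[j] x * WittVector.frobenius^[i] y) := by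
  rcases subsingleton_or_nontrivial R with h | h
  · ext i; exact Subsingleton.elim _ _
  · have := charP_of_nontrivial p k (R := R)
    exact WittVector.iterate_verschiebung_mul x y i j

/-- In characteristic `p` one has `p = V F`, and `V` commutes with `F`. -/
lemma natCast_pow_mul_iterate_verschiebung (x : WittVector p R) (i j : ℕ) :
    (p : WittVector p R) ^ i * WittVector.verschiebung^[j] x =
      WittVector.verschiebung^[i + j] (WittVector.frobenius^[i] x) := by
  rcases subsingleton_or_nontrivial R with h | h
  · ext i; exact Subsingleton.elim _ _
  · have := charP_of_nontrivial p k (R := R)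
    have h1 : ∀ y : WittVector p R, (p : WittVector p R) ^ i * y =
        WittVector.verschiebung^[i] (WittVector.frobenius^[i] y) := by
      intro y
      induction i with
      | zero => simp
      | succ i ih =>
        rw [pow_succ', mul_assoc, ih, Function.iterate_succ_apply', Function.iterate_succ_apply,
          mul_comm, ← WittVector.verschiebung_frobenius,
          (WittVector.verschiebung_frobenius_comm.symm.iterate_right i).eq,
          (Function.Commute.refl WittVector.frobenius).iterate_right i |>.eq]
    rw [h1, Function.iterate_add_apply]
    congr 1
    exact ((WittVector.verschiebung_frobenius_comm.symm.iterate_left i).iterate_right j).eq x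

lemma iterate_frobenius_teichmuller (x : R) (i : ℕ) :
    WittVector.frobenius^[i] (WittVector.teichmuller p x) =
      WittVector.teichmuller p (x ^ p ^ i) := by
  rcases subsingleton_or_nontrivial R with h | h
  · ext i; exact Subsingleton.elim _ _
  · have := charP_of_nontrivial p k (R := R)
    induction i with
    | zero => simp
    | succ i ih =>
      rw [Function.iterate_succ_apply', ih, WittVector.frobenius_eq_map_frobenius,
        WittVector.map_teichmuller, frobenius_def, ← pow_mul, pow_succ]

omit k in
lemma exists_eq_verschiebung {x : WittVector p R} (hx : x.coeff 0 = 0) :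
    ∃ y, x = WittVector.verschiebung y :=
  ⟨x.shift 1, WittVector.eq_iterate_verschiebung (n := 1) fun i hi => by
    obtain rfl : i = 0 := by omega
    exact hx⟩

omit k in
lemma exists_eq_teichmuller_add (x : WittVector p R) :
    ∃ y, x = WittVector.teichmuller p (x.coeff 0) + WittVector.verschiebung y := by
  obtain ⟨y, hy⟩ := exists_eq_verschiebung p (x := x - WittVector.teichmuller p (x.coeff 0)) (by
    change WittVector.constantCoeff (x - WittVector.teichmuller p (x.coeff 0)) = 0
    rw [map_sub]
    change x.coeff 0 - (WittVector.teichmuller p (x.coeff 0)).coeff 0 = 0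
    rw [WittVector.teichmuller_coeff_zero, sub_self])
  exact ⟨y, by rw [← hy]; ring⟩

-- The Teichmüller map is additive modulo `V`; this makes `lead` additive modulo the next step of
-- the filtration.
omit k in
lemma exists_teichmuller_add (x y : R) :
    ∃ z, WittVector.teichmuller p x + WittVector.teichmuller p y =
      WittVector.teichmuller p (x + y) + WittVector.verschiebung z := by
  have h : (WittVector.teichmuller p x + WittVector.teichmuller p y).coeff 0 = x + y := by
    change WittVector.constantCoeff
      (WittVector.teichmuller p x + WittVector.teichmuller p y) = _
    rw [map_add]
    change (WittVector.teichmuller p x).coeff 0 + (WittVector.teichmuller p y).coeff 0 = _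
    simp
  obtain ⟨z, hz⟩ := exists_eq_teichmuller_add p
    (WittVector.teichmuller p x + WittVector.teichmuller p y)
  exact ⟨z, by rw [h] at hz; exact hz⟩

omit k in
lemma iterate_verschiebung_add (x y : WittVector p R) (i : ℕ) :
    WittVector.verschiebung^[i] (x + y) =
      WittVector.verschiebung^[i] x + WittVector.verschiebung^[i] y := by
  induction i with
  | zero => rfl
  | succ i ih => simp only [Function.iterate_succ_apply', ih, map_add]

omit k in
lemma map_iterate_verschiebung {S : Type u} [CommRing S] (f : R →+* S) (x : WittVector p R)
    (i : ℕ) : WittVector.map f (WittVector.verschiebung^[i] x) =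
      WittVector.verschiebung^[i] (WittVector.map f x) := by
  induction i with
  | zero => rfl
  | succ i ih => rw [Function.iterate_succ_apply', Function.iterate_succ_apply',
      WittVector.map_verschiebung, ih]

end Witt

/-! ### The graded pieces of the filtration of `O ⊗_{W(k)} W(R)` -/

section Filtration

variable {p : ℕ} [Fact p.Prime] {O : Type u} [CommRing O] [IsLocalRing O]
  [CharP (ResidueField O) p] [Finite (ResidueField O)] [IsAdicComplete (maximalIdeal O) O]
  {R : Type u} [CommRing R] [Algebra (ResidueField O) R]
  {S : Type u} [CommRing S] [Algebra (ResidueField O) S]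

lemma tmul_mem_fil {h s : ℕ} {a : O} (ha : (p : O) ^ s * a ∈ maximalIdeal O ^ h)
    (w : WittVector p R) : (a ⊗ₜ (WittVector.verschiebung^[s] w) : Big p O R) ∈ fil p O R h :=
  Ideal.subset_span ⟨a, s, w, ha, rfl⟩

lemma wittHom_mul_tmul (b : WittVector p (ResidueField O)) (a : O) (w : WittVector p R) :
    ((wittHom p O b * a) ⊗ₜ w : Big p O R) =
      a ⊗ₜ (WittVector.map (algebraMap (ResidueField O) R) b * w) := by
  have h1 : wittHom p O b * a = b • a := rfl
  have h2 : WittVector.map (algebraMap (ResidueField O) R) b * w = b • w := rfl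
  rw [h1, h2, TensorProduct.smul_tmul]

/-- The ideal `fil p O R h` is generated by its defining elements as an additive group. -/
lemma fil_induction {h : ℕ} {P : Big p O R → Prop} (zero : P 0)
    (add : ∀ x y, P x → P y → P (x + y))
    (tmul : ∀ (a : O) (s : ℕ) (w : WittVector p R), (p : O) ^ s * a ∈ maximalIdeal O ^ h →
      P (a ⊗ₜ (WittVector.verschiebung^[s] w))) {x : Big p O R} (hx : x ∈ fil p O R h) : P x := by
  set T : Set (Big p O R) := {x | ∃ (a : O) (s : ℕ) (w : WittVector p R),
    (p : O) ^ s * a ∈ maximalIdeal O ^ h ∧ x = a ⊗ₜ (WittVector.verschiebung^[s] w)}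
  have key : x ∈ AddSubmonoid.closure T := by
    refine Submodule.span_induction (p := fun x _ => x ∈ AddSubmonoid.closure T)
      (fun x hx => AddSubmonoid.subset_closure hx) (zero_mem _)
      (fun x y _ _ hx hy => add_mem hx hy) (fun b x hm hx' => ?_) hx
    clear hx hm
    induction hx' using AddSubmonoid.closure_induction with
    | zero => simp
    | add x y _ _ hx hy => rw [smul_add]; exact add_mem hx hy
    | mem x hx =>
      obtain ⟨a, s, w, ha, rfl⟩ := hx
      induction b using TensorProduct.induction_on with
      | zero => simp
      | add x y hx hy => rw [add_smul]; exact add_mem hx hy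
      | tmul c v =>
        -- A multiple of a generator by a pure tensor is again a generator, by `V^s w * v = V^s (w *
        -- F^s v)`.
        rw [smul_eq_mul, Algebra.TensorProduct.tmul_mul_tmul, mul_comm v,
          WittVector.iterate_verschiebung_mul_left]
        refine AddSubmonoid.subset_closure ⟨_, _, _, ?_, rfl⟩
        rw [mul_left_comm]
        exact Ideal.mul_mem_left _ _ ha
  clear hx
  induction key using AddSubmonoid.closure_induction with
  | zero => exact zero
  | add x y _ _ hx hy => exact add _ _ hx hy
  | mem x hx => obtain ⟨a, s, w, ha, rfl⟩ := hx; exact tmul a s w ha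

/-- On generators this is `V^s w * V^t v = V^(s+t) (F^t w * F^s v)`. -/
lemma mul_mem_fil {i j : ℕ} {x y : Big p O R} (hx : x ∈ fil p O R i) (hy : y ∈ fil p O R j) :
    x * y ∈ fil p O R (i + j) := by
  refine fil_induction (P := fun x => x * y ∈ fil p O R (i + j)) (by simp)
    (fun x x' hx hx' => by rw [add_mul]; exact add_mem hx hx') (fun a s w ha => ?_) hx
  refine fil_induction (P := fun y => _ * y ∈ fil p O R (i + j)) (by simp)
    (fun x x' hx hx' => by rw [mul_add]; exact add_mem hx hx') (fun b t v hb => ?_) hy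
  rw [Algebra.TensorProduct.tmul_mul_tmul, iterate_verschiebung_mul_iterate p (ResidueField O)]
  refine tmul_mem_fil ?_ _
  rw [pow_add (p : O), mul_mul_mul_comm, pow_add]
  exact Ideal.mul_mem_mul ha hb

lemma pow_mem_fil {x : Big p O R} (hx : x ∈ fil p O R 1) (i : ℕ) : x ^ i ∈ fil p O R i := by
  induction i with
  | zero =>
    have h1 : (1 : Big p O R) = algebraMap O (Big p O R) 1 := (map_one _).symm
    rw [pow_zero, h1]
    exact algebraMap_mem_fil p O (by simp)
  | succ i ih => rw [pow_succ]; exact mul_mem_fil ih hx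

lemma fil_zero : fil p O R 0 = ⊤ := by
  rw [Ideal.eq_top_iff_one]
  simpa using pow_mem_fil (zero_mem (fil p O R 1)) 0

/-- The reduction `O ⊗_{W(k)} W(R) → R` modulo `fil p O R 1`. -/
def res : Big p O R →+* R :=
  letI : Algebra (WittVector p (ResidueField O)) R :=
    ((algebraMap (ResidueField O) R).comp WittVector.constantCoeff).toAlgebra
  (Algebra.TensorProduct.lift (R := WittVector p (ResidueField O))
    (S := WittVector p (ResidueField O))
    (A := O) (B := WittVector p R) (C := R)
    { (algebraMap (ResidueField O) R).comp (residue O) with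
      commutes' := fun w => congrArg (algebraMap (ResidueField O) R) (residue_wittHom p O w) }
    { (WittVector.constantCoeff : WittVector p R →+* R) with
      commutes' := fun w => WittVector.map_coeff _ w 0 } (fun _ _ => Commute.all _ _) :
      Big p O R →ₐ[WittVector p (ResidueField O)] R)

lemma res_tmul (a : O) (w : WittVector p R) :
    res (a ⊗ₜ w : Big p O R) = algebraMap (ResidueField O) R (residue O a) * w.coeff 0 := rfl

lemma res_bigMap (f : R →ₐ[ResidueField O] S) (x : Big p O R) :
    res (bigMap p O f x) = f (res x) := by
  induction x using TensorProduct.induction_on with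
  | zero => simp
  | add x y hx hy => simp only [map_add, hx, hy]
  | tmul a w =>
    have h1 : bigMap p O f (a ⊗ₜ w) = a ⊗ₜ (WittVector.map (f : R →+* S) w) := rfl
    rw [h1, res_tmul, res_tmul, map_mul, f.commutes, WittVector.map_coeff]
    rfl

lemma res_bigFrob (x : Big p O R) : res (bigFrob p O x) = res x ^ Nat.card (ResidueField O) := by
  rw [bigFrob, res_bigMap, frobHom_apply]

lemma res_bigFrob_iterate (x : Big p O R) (i : ℕ) :
    res ((bigFrob p O)^[i] x) = res x ^ Nat.card (ResidueField O) ^ i := by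
  induction i with
  | zero => simp
  | succ i ih => rw [Function.iterate_succ_apply', res_bigFrob, ih, ← pow_mul, pow_succ]

lemma res_eq_zero_of_mem {x : Big p O R} (hx : x ∈ fil p O R 1) : res x = 0 := by
  refine fil_induction (P := fun x => res x = 0) (map_zero _)
    (fun x y hx hy => by rw [map_add, hx, hy, add_zero]) (fun a s w ha => ?_) hx
  rw [res_tmul]
  rcases s with _ | s
  · rw [pow_zero, one_mul, pow_one] at ha
    rw [(residue_eq_zero_iff a).2 ha, map_zero, zero_mul]
  · rw [Function.iterate_succ_apply', WittVector.verschiebung_coeff_zero, mul_zero]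

end Filtration

/-! ### Each graded piece is a copy of `R` -/

section Lead

variable {p : ℕ} [Fact p.Prime] {O : Type u} [CommRing O] [IsDomain O] [IsDiscreteValuationRing O]
  [CharP (ResidueField O) p] {ϖ : O}

/-- The canonical element of `fil p O R h` with leading coefficient `x`. -/
def lead [Finite (ResidueField O)] [IsAdicComplete (maximalIdeal O) O] (hϖ : Irreducible ϖ)
    {R : Type u} [CommRing R] [Algebra (ResidueField O) R] (h : ℕ) (x : R) : Big p O R :=
  cofactor p hϖ h ⊗ₜ (WittVector.verschiebung^[expo p hϖ h] (WittVector.teichmuller p x))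

variable [Finite (ResidueField O)] [IsAdicComplete (maximalIdeal O) O]
  {R : Type u} [CommRing R] [Algebra (ResidueField O) R]
  {S : Type u} [CommRing S] [Algebra (ResidueField O) S]
  (hϖ : Irreducible ϖ)

lemma lead_mem_fil (h : ℕ) (x : R) : lead (p := p) hϖ h x ∈ fil p O R h :=
  tmul_mem_fil (by rw [pow_expo_mul_cofactor, mem_maximalIdeal_pow hϖ]) _

/-- By maximality of `s = expo p hϖ h`, the power `p ^ (s + 1)` already lies in `𝔪 ^ (h + 1)`. So
only the zeroth Witt coefficient matters behind `c ⊗ V^s`. -/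
lemma cofactor_tmul_verschiebung_mem (h : ℕ) (w : WittVector p R) :
    (cofactor p hϖ h ⊗ₜ (WittVector.verschiebung^[expo p hϖ h] (WittVector.verschiebung w)) :
      Big p O R) ∈ fil p O R (h + 1) := by
  rw [← Function.iterate_succ_apply]
  refine tmul_mem_fil ?_ _
  rw [mem_maximalIdeal_pow hϖ]
  exact (dvd_pow_expo_succ p hϖ h).mul_right _

lemma lead_zero (h : ℕ) : lead (p := p) hϖ h (0 : R) = 0 := by
  have h1 : ∀ i, WittVector.verschiebung^[i] (0 : WittVector p R) = 0 := fun i => by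
    induction i with
    | zero => rfl
    | succ i ih => rw [Function.iterate_succ_apply', ih, map_zero]
  rw [lead, WittVector.teichmuller_zero, h1, TensorProduct.tmul_zero]

lemma lead_add (h : ℕ) (x y : R) : lead hϖ h x + lead hϖ h y - lead hϖ h (x + y) ∈
    fil p O R (h + 1) := by
  obtain ⟨z, hz⟩ := exists_teichmuller_add p x y
  rw [lead, lead, ← TensorProduct.tmul_add, ← iterate_verschiebung_add, hz,
    iterate_verschiebung_add, TensorProduct.tmul_add, lead, add_sub_cancel_left]
  exact cofactor_tmul_verschiebung_mem hϖ h z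

lemma bigMap_lead (f : R →ₐ[ResidueField O] S) (h : ℕ) (x : R) :
    bigMap p O f (lead hϖ h x) = lead hϖ h (f x) := by
  have h1 : ∀ a w, bigMap p O f (a ⊗ₜ w) = a ⊗ₜ (WittVector.map (f : R →+* S) w) :=
    fun _ _ => rfl
  rw [lead, h1, map_iterate_verschiebung, WittVector.map_teichmuller]
  rfl

/-- The element `ϖʰ ⊗ [x]` in terms of `lead`. -/
lemma pow_tmul_teichmuller (h : ℕ) (x : R) :
    ((ϖ ^ h) ⊗ₜ (WittVector.teichmuller p x) : Big p O R) = lead hϖ h (x ^ p ^ expo p hϖ h) := by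
  -- The factor `p ^ s` of `ϖ ^ h` crosses the tensor sign and acts as `V^s F^s`; the `F^s` produces
  -- the exponent `p ^ s`.
  have h1 : ϖ ^ h = wittHom p O (p ^ expo p hϖ h) * cofactor p hϖ h := by
    rw [map_pow, map_natCast, pow_expo_mul_cofactor]
  rw [h1, wittHom_mul_tmul, map_pow, map_natCast]
  have h2 := natCast_pow_mul_iterate_verschiebung p (ResidueField O)
    (WittVector.teichmuller p x) (expo p hϖ h) 0
  rw [Function.iterate_zero_apply] at h2
  rw [h2, iterate_frobenius_teichmuller p (ResidueField O), add_zero]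
  rfl

/-- For a generator `a ⊗ V^r w` only the Teichmüller part of `w` counts. If `p ^ r * a` has
valuation exactly `h`, then `r ≤ s` and `a = p ^ (s - r) * cofactor * c`; modulo `𝔪` the scalar `c`
may be replaced by the image of the Teichmüller representative of its residue, and then all scalars
cross the tensor sign. -/
lemma exists_lead {h : ℕ} {z : Big p O R} (hz : z ∈ fil p O R h) :
    ∃ x, z - lead hϖ h x ∈ fil p O R (h + 1) := by
  refine fil_induction (P := fun z => ∃ x, z - lead hϖ h x ∈ fil p O R (h + 1))
    ⟨0, by rw [lead_zero, sub_zero]; exact zero_mem _⟩ ?_ ?_ hz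
  · rintro z z' ⟨x, hx⟩ ⟨x', hx'⟩
    refine ⟨x + x', ?_⟩
    convert add_mem (add_mem hx hx') (lead_add hϖ h x x') using 1
    ring
  intro a r w ha
  obtain ⟨y, hy⟩ := exists_eq_teichmuller_add p w
  have hy' : (a ⊗ₜ (WittVector.verschiebung^[r] w) : Big p O R) =
      a ⊗ₜ (WittVector.verschiebung^[r] (WittVector.teichmuller p (w.coeff 0))) +
        a ⊗ₜ (WittVector.verschiebung^[r + 1] y) := by
    conv_lhs => rw [hy]
    rw [iterate_verschiebung_add, TensorProduct.tmul_add, Function.iterate_succ_apply]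
  have hmem : (a ⊗ₜ (WittVector.verschiebung^[r + 1] y) : Big p O R) ∈ fil p O R (h + 1) := by
    refine tmul_mem_fil ?_ _
    rw [pow_succ' (p : O), mul_assoc, pow_succ']
    exact Ideal.mul_mem_mul (natCast_mem_maximalIdeal O p) ha
  suffices H : ∃ x, a ⊗ₜ (WittVector.verschiebung^[r] (WittVector.teichmuller p (w.coeff 0))) -
      lead hϖ h x ∈ fil p O R (h + 1) by
    obtain ⟨x, hx⟩ := H
    refine ⟨x, ?_⟩
    rw [hy', add_sub_right_comm]
    exact add_mem hx hmem
  by_cases ha' : (p : O) ^ r * a ∈ maximalIdeal O ^ (h + 1)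
  · exact ⟨0, by rw [lead_zero, sub_zero]; exact tmul_mem_fil ha' _⟩
  rw [mem_maximalIdeal_pow hϖ] at ha ha'
  obtain ⟨c, hc⟩ := ha
  set s := expo p hϖ h with hs
  have hr : r ≤ s := by
    by_contra hr
    exact ha' (((dvd_pow_expo_succ p hϖ h).trans (pow_dvd_pow _ (by omega))).mul_right _)
  have hp0 : (p : O) ^ r ≠ 0 := fun h0 => ha' (by rw [h0, zero_mul]; exact dvd_zero _)
  have ha2 : a = (p : O) ^ (s - r) * cofactor p hϖ h * c := by
    apply mul_left_cancel₀ hp0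
    rw [hc, ← pow_expo_mul_cofactor p hϖ h, ← hs, ← mul_assoc, ← mul_assoc, ← pow_add,
      Nat.add_sub_cancel' hr]
  set ζ := WittVector.teichmuller p (residue O c)
  have hd : c - wittHom p O ζ ∈ maximalIdeal O := by
    rw [← residue_eq_zero_iff, map_sub, residue_wittHom, WittVector.teichmuller_coeff_zero,
      sub_self]
  have ha3 : a = wittHom p O (ζ * p ^ (s - r)) * cofactor p hϖ h +
      (p : O) ^ (s - r) * cofactor p hϖ h * (c - wittHom p O ζ) := by
    rw [map_mul, map_pow, map_natCast]
    conv_lhs => rw [ha2]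
    ring
  -- Multiplication by `p ^ (s - r) = V^(s-r) F^(s-r)` raises `w.coeff 0` to the power `p ^ (s -
  -- r)`, and moving the Teichmüller factor inside `V^s` raises it to the power `p ^ s`.
  refine ⟨w.coeff 0 ^ p ^ (s - r) * algebraMap (ResidueField O) R (residue O c) ^ p ^ s, ?_⟩
  have h1 : (wittHom p O (ζ * p ^ (s - r)) * cofactor p hϖ h) ⊗ₜ
      (WittVector.verschiebung^[r] (WittVector.teichmuller p (w.coeff 0))) = lead (p := p) hϖ h
      (w.coeff 0 ^ p ^ (s - r) * algebraMap (ResidueField O) R (residue O c) ^ p ^ s) := by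
    rw [wittHom_mul_tmul, map_mul, map_pow, map_natCast, WittVector.map_teichmuller, mul_assoc,
      natCast_pow_mul_iterate_verschiebung p (ResidueField O),
      iterate_frobenius_teichmuller p (ResidueField O), Nat.sub_add_cancel hr, mul_comm,
      WittVector.iterate_verschiebung_mul_left, iterate_frobenius_teichmuller p (ResidueField O),
      ← map_mul]
    rfl
  conv in a ⊗ₜ _ => rw [ha3]
  rw [TensorProduct.add_tmul, h1, add_sub_cancel_left]
  refine tmul_mem_fil ?_ _
  rw [mul_assoc, ← mul_assoc, ← pow_add, Nat.add_sub_cancel' hr, ← mul_assoc, hs,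
    pow_expo_mul_cofactor, pow_succ]
  exact Ideal.mul_mem_mul ((mem_maximalIdeal_pow hϖ).2 dvd_rfl) hd

/-- The functional `ℓ` of `exists_functional` induces an additive map `a ⊗ w ↦ ℓ(a) w` to Witt
vectors of length `s + 1`. It kills `fil (h + 1)` and sends `lead x` to `V^s [x]`, from which `x` is
read off as the last coefficient. -/
lemma lead_injective {h : ℕ} {x y : R} (hxy : lead hϖ h x - lead hϖ h y ∈ fil p O R (h + 1)) :
    x = y := by
  set s := expo p hϖ h
  obtain ⟨ℓ, hℓ, hℓ0, hℓ1⟩ := exists_functional p hϖ h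
  have htr : ∀ (i : ℕ) (w : WittVector p R), s + 1 ≤ i →
      WittVector.truncate (s + 1) (WittVector.verschiebung^[i] w) = 0 := by
    intro i w hi
    rw [← RingHom.mem_ker, WittVector.mem_ker_truncate]
    exact fun j hj => WittVector.iterate_verschiebung_coeff_eq_zero w (by omega)
  have hp : ∀ (i j : ℕ) (w : WittVector p R), s + 1 ≤ i + j → WittVector.truncate (s + 1)
      ((p : WittVector p R) ^ i * WittVector.verschiebung^[j] w) = 0 := by
    intro i j w hi
    rw [natCast_pow_mul_iterate_verschiebung p (ResidueField O), htr _ _ hi]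
  let κ : WittVector p (ResidueField O) ⧸
        Ideal.span {(p : WittVector p (ResidueField O)) ^ (s + 1)} →+*
      TruncatedWittVector p (s + 1) R :=
    Ideal.Quotient.lift _ ((WittVector.truncate (s + 1)).comp
      (WittVector.map (algebraMap (ResidueField O) R))) (by
        intro a ha
        rw [Ideal.mem_span_singleton] at ha
        obtain ⟨b, rfl⟩ := ha
        rw [map_mul, map_pow, map_natCast]
        have := hp (s + 1) 0 1 (by omega)
        rw [Function.iterate_zero_apply, mul_one, map_pow, map_natCast] at this
        rw [this, zero_mul])
  have hκ : ∀ b, κ (Ideal.Quotient.mk _ b) = WittVector.truncate (s + 1)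
      (WittVector.map (algebraMap (ResidueField O) R) b) := fun b => rfl
  let D : Big p O R →+ TruncatedWittVector p (s + 1) R := TensorProduct.liftAddHom
    ((AddMonoidHom.mul.comp (κ.toAddMonoidHom.comp ℓ)).compl₂
      (WittVector.truncate (p := p) (R := R) (s + 1)).toAddMonoidHom) (by
      intro b a w
      change κ (ℓ (wittHom p O b * a)) * WittVector.truncate (s + 1) w = κ (ℓ a) *
        WittVector.truncate (s + 1) (WittVector.map (algebraMap (ResidueField O) R) b * w)
      rw [hℓ, map_mul, hκ, map_mul]
      ring)
  have hD : ∀ a w, D (a ⊗ₜ w) = κ (ℓ a) * WittVector.truncate (s + 1) w := fun a w => rfl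
  have hD0 : ∀ z ∈ fil p O R (h + 1), D z = 0 := by
    intro z hz
    refine fil_induction (P := fun z => D z = 0) (map_zero _)
      (fun x y hx hy => by rw [map_add, hx, hy, add_zero]) (fun a r w ha => ?_) hz
    rw [hD]
    by_cases hr : s + 1 ≤ r
    · rw [htr _ _ hr, mul_zero]
    have hr' : r ≤ s := by omega
    obtain ⟨L, hL⟩ := Ideal.Quotient.mk_surjective (ℓ a)
    have h1 := hℓ0 _ ((mem_maximalIdeal_pow hϖ).1 ha)
    have h2 : (p : O) ^ r * a = wittHom p O (p ^ r) * a := by rw [map_pow, map_natCast]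
    rw [h2, hℓ, ← hL, ← map_mul, Ideal.Quotient.eq_zero_iff_mem, Ideal.mem_span_singleton] at h1
    obtain ⟨M, hM⟩ := h1
    -- Since `p ^ r * a` is killed by `ℓ`, the value `ℓ(a)` is a multiple of `p ^ (s + 1 - r)`.
    -- Together with `V^r` this amounts to `s + 1` Verschiebungs, which truncation kills.
    have hLM : L = p ^ (s + 1 - r) * M := by
      apply mul_left_cancel₀ (pow_ne_zero r (WittVector.p_nonzero p (ResidueField O)))
      rw [hM, ← mul_assoc, ← pow_add, Nat.add_sub_cancel' (by omega)]
    rw [← hL, hκ, ← map_mul, hLM, map_mul (WittVector.map _), mul_right_comm, map_pow,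
      map_natCast, map_mul, hp _ _ _ (by omega), zero_mul]
  have hx : ∀ x : R, D (lead hϖ h x) = WittVector.truncate (s + 1)
      (WittVector.verschiebung^[s] (WittVector.teichmuller p x)) := by
    intro x
    rw [lead, hD, hℓ1, map_one, one_mul]
  have key := hD0 _ hxy
  rw [map_sub, sub_eq_zero, hx, hx] at key
  have key2 := congrArg (fun v => TruncatedWittVector.coeff (Fin.last s) v) key
  simp only [WittVector.coeff_truncate, Fin.val_last] at key2
  have hco : ∀ x : R, (WittVector.verschiebung^[s] (WittVector.teichmuller p x)).coeff s = x := by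
    intro x
    have := WittVector.iterate_verschiebung_coeff (WittVector.teichmuller p x) s 0
    rw [zero_add] at this
    rw [this, WittVector.teichmuller_coeff_zero]
  rwa [hco, hco] at key2

end Lead

/-! ### Calculus of leading coefficients -/

section IsLead

variable {p : ℕ} [Fact p.Prime] {O : Type u} [CommRing O] [IsDomain O] [IsDiscreteValuationRing O]
  [CharP (ResidueField O) p] {ϖ : O}
  [Finite (ResidueField O)] [IsAdicComplete (maximalIdeal O) O]
  {R : Type u} [CommRing R] [Algebra (ResidueField O) R]
  {S : Type u} [CommRing S] [Algebra (ResidueField O) S]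
  {hϖ : Irreducible ϖ} {h : ℕ}

/-- The element `z` of `fil p O R h` has leading coefficient `x`. -/
def IsLead (hϖ : Irreducible ϖ) (h : ℕ) (z : Big p O R) (x : R) : Prop :=
  z - lead hϖ h x ∈ fil p O R (h + 1)

lemma isLead_lead (x : R) : IsLead (p := p) hϖ h (lead hϖ h x) x := by
  rw [IsLead, sub_self]; exact zero_mem _

lemma isLead_zero_iff {z : Big p O R} : IsLead hϖ h z 0 ↔ z ∈ fil p O R (h + 1) := by
  rw [IsLead, lead_zero, sub_zero]

namespace IsLead

variable {z z' : Big p O R} {x x' : R}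

lemma mem_fil (hz : IsLead hϖ h z x) : z ∈ fil p O R h := by
  have := add_mem (fil_anti p O (Nat.le_succ h) hz) (lead_mem_fil hϖ h x)
  rwa [sub_add_cancel] at this

lemma unique (hz : IsLead hϖ h z x) (hz' : IsLead hϖ h z x') : x = x' := by
  refine lead_injective (p := p) hϖ (h := h) ?_
  convert sub_mem hz' hz using 1
  ring

lemma congr (hz : IsLead hϖ h z x) (hzz : z' - z ∈ fil p O R (h + 1)) : IsLead hϖ h z' x := by
  have := add_mem hzz hz
  rwa [sub_add_sub_cancel] at this

lemma add (hz : IsLead hϖ h z x) (hz' : IsLead hϖ h z' x') : IsLead hϖ h (z + z') (x + x') := by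
  unfold IsLead at *
  convert add_mem (add_mem hz hz') (lead_add hϖ h x x') using 1
  ring

/-- Additivity and uniqueness suffice, so no formula for the Teichmüller representative of `-x` is
needed. -/
lemma sub (hz : IsLead hϖ h z x) (hz' : IsLead hϖ h z' x') : IsLead hϖ h (z - z') (x - x') := by
  obtain ⟨y, hy⟩ := exists_lead hϖ (sub_mem hz.mem_fil hz'.mem_fil)
  have hy' : IsLead hϖ h (z - z') y := hy
  have h1 := hy'.add hz'
  rw [sub_add_cancel] at h1
  rwa [hz.unique h1, add_sub_cancel_right]

lemma bigMap (hz : IsLead hϖ h z x) (f : R →ₐ[ResidueField O] S) :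
    IsLead hϖ h (bigMap p O f z) (f x) := by
  have := fil_le_comap p O f _ hz
  rwa [Ideal.mem_comap, map_sub, bigMap_lead] at this

lemma bigFrob (hz : IsLead hϖ h z x) :
    IsLead hϖ h (bigFrob p O z) (x ^ Nat.card (ResidueField O)) := by
  have := hz.bigMap (frobHom (ResidueField O) R)
  rwa [frobHom_apply] at this

lemma bigFrob_iterate (hz : IsLead hϖ h z x) (i : ℕ) :
    IsLead hϖ h ((DivisionLusztig.bigFrob p O)^[i] z) (x ^ Nat.card (ResidueField O) ^ i) := by
  induction i with
  | zero => simpa using hz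
  | succ i ih =>
    rw [Function.iterate_succ_apply', pow_succ, pow_mul]
    exact ih.bigFrob

end IsLead

lemma lead_zero_eq (hϖ : Irreducible ϖ) (x : R) :
    lead (p := p) hϖ 0 x = 1 ⊗ₜ (WittVector.teichmuller p x) := by
  have h1 := pow_expo_mul_cofactor p hϖ 0
  have h2 : expo p hϖ 0 = 0 := by
    by_contra h0
    obtain ⟨s, hs⟩ := Nat.exists_eq_succ_of_ne_zero h0
    rw [hs, pow_succ', mul_assoc, pow_zero] at h1
    exact (mem_nonunits_iff.1 ((mem_maximalIdeal _).1 (natCast_mem_maximalIdeal O p)))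
      (IsUnit.of_mul_eq_one _ h1)
  rw [h2, pow_zero, one_mul, pow_zero] at h1
  rw [lead, h1, h2]
  rfl

lemma isLead_res (hϖ : Irreducible ϖ) (b : Big p O R) : IsLead hϖ 0 b (res b) := by
  obtain ⟨x, hx⟩ := exists_lead hϖ (z := b) (h := 0) (by rw [fil_zero]; trivial)
  have h1 := res_eq_zero_of_mem hx
  rw [map_sub, lead_zero_eq, res_tmul, map_one, map_one, one_mul,
    WittVector.teichmuller_coeff_zero, sub_eq_zero] at h1
  rw [h1]
  exact hx

lemma mem_fil_one_iff (hϖ : Irreducible ϖ) {b : Big p O R} : b ∈ fil p O R 1 ↔ res b = 0 := by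
  refine ⟨res_eq_zero_of_mem, fun hb => ?_⟩
  have := isLead_res hϖ b
  rwa [hb, isLead_zero_iff] at this

/-- Modulo `fil 1` the factor `b` is the Teichmüller representative of its residue, and moving that
inside `V^s` raises it to the power `p ^ s`. Thus `Big` acts on the graded piece through a Frobenius
twist of `R`. -/
lemma IsLead.mul_left {z : Big p O R} {x : R} (hz : IsLead hϖ h z x) (b : Big p O R) :
    IsLead hϖ h (b * z) (res b ^ p ^ expo p hϖ h * x) := by
  have h1 : (1 ⊗ₜ WittVector.teichmuller p (res b) : Big p O R) * lead hϖ h x =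
      lead hϖ h (res b ^ p ^ expo p hϖ h * x) := by
    rw [lead, Algebra.TensorProduct.tmul_mul_tmul, one_mul, mul_comm,
      WittVector.iterate_verschiebung_mul_left, iterate_frobenius_teichmuller p (ResidueField O),
      ← map_mul, mul_comm x]
    rfl
  have h2 := isLead_res hϖ b
  rw [IsLead, lead_zero_eq] at h2
  rw [IsLead, ← h1]
  have h3 := add_mem (Ideal.mul_mem_left _ b hz) ((add_comm (0 + 1) h).trans
    (congrArg (h + ·) (zero_add 1)) ▸ mul_mem_fil (i := 0 + 1) (j := h) h2
      (lead_mem_fil (p := p) hϖ h x))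
  convert h3 using 1
  ring

/-- An inverse of the residue lifts to an inverse modulo `fil 1`, and elements of `fil 1` are
nilpotent modulo `fil h`. -/
lemma isUnit_mk_iff (hϖ : Irreducible ϖ) (hh : 1 ≤ h) {b : Big p O R} :
    IsUnit (Ideal.Quotient.mk (fil p O R h) b) ↔ IsUnit (res b) := by
  constructor
  · intro hb
    exact hb.map (Ideal.Quotient.lift (fil p O R h) res
      fun a ha => res_eq_zero_of_mem (fil_anti p O hh ha))
  · intro hb
    obtain ⟨v, hv⟩ := hb.exists_right_inv
    set c : Big p O R := 1 ⊗ₜ WittVector.teichmuller p v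
    have hc : res c = v := by
      rw [res_tmul, map_one, map_one, one_mul, WittVector.teichmuller_coeff_zero]
    have h1 : b * c - 1 ∈ fil p O R 1 := by
      rw [mem_fil_one_iff hϖ, map_sub, map_mul, hc, hv, map_one, sub_self]
    have h2 : IsNilpotent (Ideal.Quotient.mk (fil p O R h) (b * c - 1)) := by
      refine ⟨h, ?_⟩
      rw [← map_pow, Ideal.Quotient.eq_zero_iff_mem]
      exact pow_mem_fil h1 h
    have h3 := h2.isUnit_add_one
    rw [← map_one (Ideal.Quotient.mk (fil p O R h)), ← map_add, sub_add_cancel, map_mul] at h3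
    exact isUnit_of_mul_isUnit_left h3

end IsLead

/-! ### The determinant of `lusztigMatrix` -/

section Det

/-- If `σ i ≤ i` for all `i`, comparing the sums of both sides forces equality. Hence every
non-identity term of the determinant contains an entry below the diagonal, which carries a factor
`ϖ`. -/
lemma exists_lt_of_ne_one {n : ℕ} {σ : Equiv.Perm (Fin n)} (hσ : σ ≠ 1) : ∃ i, i < σ i := by
  by_contra! hle
  refine hσ (Equiv.ext fun i => ?_)
  have hsum : ∑ i : Fin n, ((σ i : Fin n) : ℕ) = ∑ i : Fin n, (i : ℕ) :=
    Equiv.sum_comp σ (fun i : Fin n => (i : ℕ))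
  have heq := (Finset.sum_eq_sum_iff_of_le (fun i _ => Fin.le_def.mp (hle i))).mp hsum
  exact Fin.ext (heq i (Finset.mem_univ i))

section General

variable {p : ℕ} [Fact p.Prime] {O : Type u} [CommRing O] [IsLocalRing O]
  [CharP (ResidueField O) p] {ϖ : O}
  [Finite (ResidueField O)] [IsAdicComplete (maximalIdeal O) O]
  {R : Type u} [CommRing R] [Algebra (ResidueField O) R] {h n : ℕ} {m : ℤ}

/-- The product of the diagonal entries of `lusztigMatrix ϖ n m a`. -/
def diagProd (n : ℕ) (m : ℤ) (a : ZMod n → Big p O R) : Big p O R :=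
  ∏ i : Fin n, (bigFrob p O)^[(i : ℕ)] (a (m : ZMod n))

/-- The off-diagonal part of the determinant is divisible by `ϖ`. -/
lemma det_sub_diagProd_sub_mem (hϖ : ϖ ∈ maximalIdeal O) {a b : ZMod n → Big p O R}
    (hab : ∀ l, a l - b l ∈ fil p O R h) :
    ((lusztigMatrix ϖ n m a).det - diagProd n m a) -
      ((lusztigMatrix ϖ n m b).det - diagProd n m b) ∈ fil p O R (h + 1) := by
  have hfrob : ∀ (i : ℕ) (l : ZMod n),
      (bigFrob p O)^[i] (a l) - (bigFrob p O)^[i] (b l) ∈ fil p O R h := by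
    intro i l
    have h1 := bigFrob_iterate_mem (hab l) i
    rw [bigFrob_iterate, map_sub, ← bigFrob_iterate, ← bigFrob_iterate] at h1
    exact h1
  have hdet : ∀ a : ZMod n → Big p O R, (lusztigMatrix ϖ n m a).det - diagProd n m a =
      ∑ σ ∈ Finset.univ.erase (1 : Equiv.Perm (Fin n)),
        Equiv.Perm.sign σ • ∏ i, lusztigMatrix ϖ n m a (σ i) i := by
    intro a
    rw [Matrix.det_apply, ← Finset.add_sum_erase _ _ (Finset.mem_univ (1 : Equiv.Perm (Fin n))),
      sub_eq_iff_eq_add, add_comm]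
    congr 1
    simp [diagProd, lusztigMatrix]
  rw [hdet, hdet, ← Finset.sum_sub_distrib]
  refine Ideal.sum_mem _ fun σ hσ => ?_
  rw [← smul_sub]
  suffices hmem : (∏ i, lusztigMatrix ϖ n m a (σ i) i) - ∏ i, lusztigMatrix ϖ n m b (σ i) i ∈
      fil p O R (h + 1) by
    rcases Int.units_eq_one_or (Equiv.Perm.sign σ) with hs | hs <;> rw [hs]
    · simpa using hmem
    · simpa [Units.neg_smul] using neg_mem hmem
  obtain ⟨i₀, hi₀⟩ := exists_lt_of_ne_one (Finset.ne_of_mem_erase hσ)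
  simp only [lusztigMatrix, Matrix.of_apply, Finset.prod_mul_distrib]
  rw [← mul_sub]
  have hdvd : algebraMap O (Big p O R) ϖ ∣
      ∏ i : Fin n, (if i < σ i then algebraMap O (Big p O R) ϖ else 1) := by
    have h1 := Finset.dvd_prod_of_mem
      (fun i : Fin n => if i < σ i then algebraMap O (Big p O R) ϖ else 1) (Finset.mem_univ i₀)
    simpa only [if_pos hi₀] using h1
  obtain ⟨d, hd⟩ := hdvd
  rw [hd, mul_comm _ d, mul_assoc]
  refine Ideal.mul_mem_left _ _ (unif_mul_mem_fil (h := h + 1) hϖ ?_)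
  rw [← Ideal.Quotient.eq, map_prod, map_prod]
  exact Finset.prod_congr rfl fun i _ => Ideal.Quotient.eq.mpr (hfrob _ _)

/-- The residue of the determinant: the "norm" `u ^ (1 + q + ⋯ + qⁿ⁻¹)`. -/
def normRes (q n : ℕ) {R : Type*} [CommRing R] (u : R) : R := ∏ i : Fin n, u ^ q ^ (i : ℕ)

/-- Both exponents equal `1 + q + ⋯ + q ^ n`. This form avoids division by `u`. -/
lemma normRes_pow_mul (q n : ℕ) {R : Type*} [CommRing R] (u : R) :
    normRes q n u ^ q * u = normRes q n u * u ^ q ^ n := by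
  unfold normRes
  rw [Fin.prod_univ_eq_prod_range (fun i => u ^ q ^ i), ← Finset.prod_pow,
    ← Finset.prod_range_succ (fun i => u ^ q ^ i), Finset.prod_range_succ']
  simp [pow_succ, pow_mul]

lemma isUnit_normRes (q n : ℕ) {R : Type*} [CommRing R] {u : R} (hu : IsUnit u) :
    IsUnit (normRes q n u) := by
  unfold normRes
  induction (Finset.univ : Finset (Fin n)) using Finset.induction_on with
  | empty => simp
  | insert a s ha ih => rw [Finset.prod_insert ha]; exact (hu.pow _).mul ih

lemma map_normRes (q n : ℕ) {R S : Type*} [CommRing R] [CommRing S] (f : R →+* S) (u : R) :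
    f (normRes q n u) = normRes q n (f u) := by
  simp [normRes, map_prod]

lemma res_diagProd (a : ZMod n → Big p O R) :
    res (diagProd n m a) = normRes (Nat.card (ResidueField O)) n (res (a (m : ZMod n))) := by
  simp only [diagProd, map_prod, res_bigFrob_iterate, normRes]

/-- Compare with the zero tuple at level `0`: the off-diagonal part of the determinant lies in `fil
1`. -/
lemma res_det [NeZero n] (hϖ : ϖ ∈ maximalIdeal O) (a : ZMod n → Big p O R) :
    res (lusztigMatrix ϖ n m a).det =
      normRes (Nat.card (ResidueField O)) n (res (a (m : ZMod n))) := by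
  have h1 := det_sub_diagProd_sub_mem (p := p) (R := R) (m := m) (h := 0) hϖ (a := a) (b := 0)
    (fun l => by rw [fil_zero]; trivial)
  have h2 : ∀ i, (bigFrob p O)^[i] (0 : Big p O R) = 0 := fun i => by
    rw [bigFrob_iterate, map_zero]
  have h3 : lusztigMatrix ϖ n m (0 : ZMod n → Big p O R) = 0 := by
    ext i j
    simp [lusztigMatrix, h2]
  have : Nonempty (Fin n) := ⟨0⟩
  have h4 : diagProd n m (0 : ZMod n → Big p O R) = 0 :=
    Finset.prod_eq_zero (Finset.mem_univ (0 : Fin n)) (h2 _)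
  rw [h3, Matrix.det_zero, h4, sub_zero, sub_zero] at h1
  rw [← res_diagProd, ← sub_eq_zero, ← map_sub]
  exact res_eq_zero_of_mem h1

end General

variable {p : ℕ} [Fact p.Prime] {O : Type u} [CommRing O] [IsDomain O] [IsDiscreteValuationRing O]
  [CharP (ResidueField O) p] {ϖ : O}
  [Finite (ResidueField O)] [IsAdicComplete (maximalIdeal O) O]
  {R : Type u} [CommRing R] [Algebra (ResidueField O) R]
  {S : Type u} [CommRing S] [Algebra (ResidueField O) S]
  {hϖ : Irreducible ϖ} {h n : ℕ} {m : ℤ}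

/-- The cross terms lie in `fil (2h)`, which is inside `fil (h + 1)` because `h ≥ 1`. -/
lemma IsLead.prod_one_add (hh : 1 ≤ h) {ι : Type*} (s : Finset ι) {z : ι → Big p O R}
    {x : ι → R} (hz : ∀ i ∈ s, IsLead hϖ h (z i) (x i)) :
    IsLead hϖ h (∏ i ∈ s, (1 + z i) - 1) (∑ i ∈ s, x i) := by
  classical
  induction s using Finset.induction_on with
  | empty => simpa using isLead_zero_iff.2 (zero_mem _)
  | insert a s ha ih =>
    rw [Finset.prod_insert ha, Finset.sum_insert ha]
    have h1 := hz a (Finset.mem_insert_self _ _)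
    have h2 := ih fun i hi => hz i (Finset.mem_insert_of_mem hi)
    refine (h1.add h2).congr ?_
    have h3 := fil_anti p O (show h + 1 ≤ h + h by omega) (mul_mem_fil h1.mem_fil h2.mem_fil)
    convert h3 using 1
    ring

/-- Multiply the `m`-th coordinate by the `1`-unit `1 + lead t`. -/
def twist (hϖ : Irreducible ϖ) (h : ℕ) (m : ℤ) (a : ZMod n → Big p O R) (t : R) :
    ZMod n → Big p O R :=
  Function.update a (m : ZMod n) (a (m : ZMod n) * (1 + lead hϖ h t))

lemma twist_same (a : ZMod n → Big p O R) (t : R) :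
    twist hϖ h m a t (m : ZMod n) = a (m : ZMod n) * (1 + lead hϖ h t) :=
  Function.update_self ..

lemma twist_of_ne (a : ZMod n → Big p O R) (t : R) {l : ZMod n} (hl : l ≠ m) :
    twist hϖ h m a t l = a l :=
  Function.update_of_ne hl ..

lemma bigMap_twist (f : R →ₐ[ResidueField O] S) (a : ZMod n → Big p O R) (t : R) (l : ZMod n) :
    bigMap p O f (twist hϖ h m a t l) = twist hϖ h m (fun l => bigMap p O f (a l)) (f t) l := by
  by_cases hl : l = m
  · rw [hl, twist_same, twist_same, map_mul, map_add, map_one, bigMap_lead]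
  · rw [twist_of_ne _ _ hl, twist_of_ne _ _ hl]

lemma isLead_twist_sub (a : ZMod n → Big p O R) (t : R) :
    IsLead hϖ h (twist hϖ h m a t (m : ZMod n) - a (m : ZMod n))
      (res (a (m : ZMod n)) ^ p ^ expo p hϖ h * t) := by
  rw [twist_same]
  convert (isLead_lead (p := p) (hϖ := hϖ) (h := h) t).mul_left (a (m : ZMod n)) using 1
  ring

lemma twist_sub_mem (a : ZMod n → Big p O R) (t : R) (l : ZMod n) :
    twist hϖ h m a t l - a l ∈ fil p O R h := by
  by_cases hl : l = m
  · rw [hl]; exact (isLead_twist_sub a t).mem_fil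
  · rw [twist_of_ne _ _ hl, sub_self]; exact zero_mem _

/-- The off-diagonal part changes only within `fil (h + 1)`, while the diagonal product is
multiplied by the conjugates of `1 + lead t`. -/
lemma isLead_det_twist (hh : 1 ≤ h) (a : ZMod n → Big p O R) (t : R) :
    IsLead hϖ h ((lusztigMatrix ϖ n m (twist hϖ h m a t)).det - (lusztigMatrix ϖ n m a).det)
      (normRes (Nat.card (ResidueField O)) n (res (a (m : ZMod n))) ^ p ^ expo p hϖ h *
        ∑ i : Fin n, t ^ Nat.card (ResidueField O) ^ (i : ℕ)) := by
  have h1 := det_sub_diagProd_sub_mem (m := m) ((mem_maximalIdeal ϖ).2 hϖ.not_isUnit)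
    (twist_sub_mem (p := p) (hϖ := hϖ) (h := h) (m := m) a t)
  have h2 : diagProd n m (twist hϖ h m a t) = diagProd n m a *
      ∏ i : Fin n, (1 + (bigFrob p O)^[(i : ℕ)] (lead hϖ h t)) := by
    simp only [diagProd, twist_same, bigFrob_iterate, map_mul, Finset.prod_mul_distrib, map_add,
      map_one]
  have h3 := (IsLead.prod_one_add (p := p) hh Finset.univ fun (i : Fin n) _ =>
    (isLead_lead (p := p) (hϖ := hϖ) (h := h) t).bigFrob_iterate (i : ℕ)).mul_left (diagProd n m a)
  rw [res_diagProd] at h3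
  refine h3.congr ?_
  rw [h2] at h1
  convert h1 using 1
  ring

lemma normRes_pow_eq [NeZero n] (hϖ : Irreducible ϖ) {a : ZMod n → Big p O R}
    (ha : bigFrob p O (lusztigMatrix ϖ n m a).det - (lusztigMatrix ϖ n m a).det ∈ fil p O R 1) :
    normRes (Nat.card (ResidueField O)) n (res (a (m : ZMod n))) ^ Nat.card (ResidueField O) =
      normRes (Nat.card (ResidueField O)) n (res (a (m : ZMod n))) := by
  have h1 := res_eq_zero_of_mem ha
  rwa [map_sub, res_bigFrob, res_det ((mem_maximalIdeal ϖ).2 hϖ.not_isUnit), sub_eq_zero] at h1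

/-- The effect of `twist` on the condition that the determinant is fixed by Frobenius. -/
lemma isLead_frob_det_twist [NeZero n] (hh : 1 ≤ h) {a : ZMod n → Big p O R} {e : R}
    (ha : IsLead hϖ h
      (bigFrob p O (lusztigMatrix ϖ n m a).det - (lusztigMatrix ϖ n m a).det) e) (t : R) :
    IsLead hϖ h (bigFrob p O (lusztigMatrix ϖ n m (twist hϖ h m a t)).det -
        (lusztigMatrix ϖ n m (twist hϖ h m a t)).det)
      (e + normRes (Nat.card (ResidueField O)) n (res (a (m : ZMod n))) ^ p ^ expo p hϖ h *
        (t ^ Nat.card (ResidueField O) ^ n - t)) := by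
  have h1 := isLead_det_twist (hϖ := hϖ) (m := m) hh a t
  have h2 := ha.add (h1.bigFrob.sub h1)
  set q := Nat.card (ResidueField O)
  -- Because `N ^ q = N`, Frobenius leaves the factor `N ^ p ^ s` alone and acts only on the sum of
  -- the `t ^ q ^ i`, so the difference telescopes to `t ^ q ^ n - t`.
  have hN := normRes_pow_eq hϖ (fil_anti p O hh ha.mem_fil)
  have hfr : (∑ i : Fin n, t ^ q ^ (i : ℕ)) ^ q = ∑ i : Fin n, t ^ q ^ ((i : ℕ) + 1) := by
    rw [← frobHom_apply (ResidueField O) R, map_sum]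
    refine Finset.sum_congr rfl fun i _ => ?_
    rw [frobHom_apply, ← pow_mul, pow_succ]
  have htel : ∑ i : Fin n, t ^ q ^ ((i : ℕ) + 1) - ∑ i : Fin n, t ^ q ^ (i : ℕ) =
      t ^ q ^ n - t := by
    rw [Fin.sum_univ_eq_sum_range (fun i => t ^ q ^ (i + 1)),
      Fin.sum_univ_eq_sum_range (fun i => t ^ q ^ i), ← Finset.sum_sub_distrib,
      Finset.sum_range_sub (fun i => t ^ q ^ i), pow_zero, pow_one]
  convert h2 using 1
  · rw [map_sub]; ring
  · rw [mul_pow, ← pow_mul, mul_comm _ q, pow_mul, hN, hfr, ← mul_sub, htel]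

end Det

/-! ### Points and their lifts -/

section PointLift

variable {p : ℕ} [Fact p.Prime] {O : Type u} [CommRing O] [IsDomain O] [IsDiscreteValuationRing O]
  [CharP (ResidueField O) p] {ϖ : O}
  [Finite (ResidueField O)] [IsAdicComplete (maximalIdeal O) O]
  {R : Type u} [CommRing R] [Algebra (ResidueField O) R]
  {S : Type u} [CommRing S] [Algebra (ResidueField O) S]
  {hϖ : Irreducible ϖ} {h n : ℕ} {m : ℤ}

lemma level_self : level n m h (m : ZMod n) = h := if_pos rfl

lemma level_of_ne {l : ZMod n} (hl : l ≠ m) : level n m h l = h - 1 := if_neg hl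

lemma level_succ (hh : 1 ≤ h) (l : ZMod n) : level n m (h + 1) l = level n m h l + 1 := by
  unfold level
  split_ifs <;> omega

/-- The point with given lifts of the coordinates. -/
def Point.ofLift (hϖ : Irreducible ϖ) (hh : 1 ≤ h) (a : ZMod n → Big p O R)
    (hu : IsUnit (res (a (m : ZMod n))))
    (ha : bigFrob p O (lusztigMatrix ϖ n m a).det - (lusztigMatrix ϖ n m a).det ∈ fil p O R h) :
    Point p O ϖ n m h R where
  coord l := Ideal.Quotient.mk _ (a l)
  isUnit_coord := (isUnit_mk_iff hϖ (by rwa [level_self])).2 hu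
  frob_det := ⟨a, fun _ => rfl, ha⟩

lemma Point.isUnit_res_lift (hϖ : Irreducible ϖ) (hh : 1 ≤ h) (x : Point p O ϖ n m h R)
    {a : ZMod n → Big p O R} (ha : ∀ l, Ideal.Quotient.mk _ (a l) = x.coord l) :
    IsUnit (res (a (m : ZMod n))) := by
  have h1 := x.isUnit_coord
  rw [← ha] at h1
  exact (isUnit_mk_iff hϖ (by rwa [level_self])).1 h1

lemma frob_det_mem_of_sub_mem (hϖ : Irreducible ϖ) {a b : ZMod n → Big p O R}
    (hab : ∀ l, b l - a l ∈ fil p O R (level n m h l))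
    (ha : bigFrob p O (lusztigMatrix ϖ n m a).det - (lusztigMatrix ϖ n m a).det ∈ fil p O R h) :
    bigFrob p O (lusztigMatrix ϖ n m b).det - (lusztigMatrix ϖ n m b).det ∈ fil p O R h := by
  have h1 := det_lusztigMatrix_sub_mem ((mem_maximalIdeal ϖ).2 hϖ.not_isUnit) b a hab
  have h2 := fil_le_comap p O (frobHom (ResidueField O) R) _ h1
  rw [Ideal.mem_comap, map_sub] at h2
  convert add_mem (sub_mem h2 h1) ha using 1
  rw [bigFrob]
  ring

lemma Point.frob_det_mem (hϖ : Irreducible ϖ) (x : Point p O ϖ n m h R)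
    {a : ZMod n → Big p O R} (ha : ∀ l, Ideal.Quotient.mk _ (a l) = x.coord l) :
    bigFrob p O (lusztigMatrix ϖ n m a).det - (lusztigMatrix ϖ n m a).det ∈ fil p O R h := by
  obtain ⟨b, hb, hb'⟩ := x.frob_det
  exact frob_det_mem_of_sub_mem hϖ
    (fun l => Ideal.Quotient.eq.1 ((ha l).trans (hb l).symm)) hb'

lemma det_lusztigMatrix_bigMap (f : R →ₐ[ResidueField O] S) (a : ZMod n → Big p O R) :
    (lusztigMatrix ϖ n m fun l => bigMap p O f (a l)).det =
      bigMap p O f (lusztigMatrix ϖ n m a).det := by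
  rw [lusztigMatrix_map]
  exact (AlgHom.map_det (bigMap p O f) (lusztigMatrix ϖ n m a)).symm

/-- Modify the coordinates different from the `m`-th one. -/
def shift (hϖ : Irreducible ϖ) (h : ℕ) (a : ZMod n → Big p O R)
    (y : {l : ZMod n // l ≠ m} → R) : ZMod n → Big p O R :=
  fun l => if hl : l = m then a l else a l + lead hϖ (h - 1) (y ⟨l, hl⟩)

lemma shift_same (a : ZMod n → Big p O R) (y : {l : ZMod n // l ≠ m} → R) :
    shift hϖ h a y (m : ZMod n) = a (m : ZMod n) := dif_pos rfl

lemma shift_of_ne (a : ZMod n → Big p O R) (y : {l : ZMod n // l ≠ m} → R) {l : ZMod n}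
    (hl : l ≠ m) : shift hϖ h a y l = a l + lead hϖ (h - 1) (y ⟨l, hl⟩) := dif_neg hl

lemma bigMap_shift (f : R →ₐ[ResidueField O] S) (a : ZMod n → Big p O R)
    (y : {l : ZMod n // l ≠ m} → R) (l : ZMod n) :
    bigMap p O f (shift hϖ h a y l) =
      shift hϖ h (fun l => bigMap p O f (a l)) (fun i => f (y i)) l := by
  by_cases hl : l = m
  · subst hl; rw [shift_same, shift_same]
  · rw [shift_of_ne _ _ hl, shift_of_ne _ _ hl, map_add, bigMap_lead]

lemma shift_sub_mem (a : ZMod n → Big p O R) (y : {l : ZMod n // l ≠ m} → R) (l : ZMod n) :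
    shift hϖ h a y l - a l ∈ fil p O R (level n m h l) := by
  by_cases hl : l = m
  · subst hl; rw [shift_same, sub_self]; exact zero_mem _
  · rw [shift_of_ne _ _ hl, add_sub_cancel_left, level_of_ne hl]
    exact lead_mem_fil _ _ _

/-- Every lift to level `h + 1` of the same level-`h` tuple is reached. Twisting moves the leading
term at `m` by a power of `res (a m)` times `t`; that power is a unit, so `t` can be solved for. -/
lemma exists_twist_shift (hh : 1 ≤ h) {a c : ZMod n → Big p O R}
    (hu : IsUnit (res (a (m : ZMod n)))) (hc : ∀ l, c l - a l ∈ fil p O R (level n m h l)) :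
    ∃ (y : {l : ZMod n // l ≠ m} → R) (t : R),
      ∀ l, twist hϖ h m (shift hϖ h a y) t l - c l ∈ fil p O R (level n m (h + 1) l) := by
  have hy : ∀ i : {l : ZMod n // l ≠ m}, ∃ y, IsLead hϖ (h - 1) (c i - a i) y := fun i => by
    have := hc i
    rw [level_of_ne i.2] at this
    exact exists_lead hϖ this
  choose y hy using hy
  have hm := hc m
  rw [level_self] at hm
  obtain ⟨x, hx⟩ := exists_lead hϖ hm
  obtain ⟨v, hv⟩ := (hu.pow (p ^ expo p hϖ h)).exists_right_inv
  refine ⟨y, v * x, fun l => ?_⟩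
  by_cases hl : l = m
  · subst hl
    have h1 := isLead_twist_sub (hϖ := hϖ) (h := h) (m := m) (shift hϖ h a y) (v * x)
    rw [shift_same, ← mul_assoc, hv, one_mul] at h1
    have h2 : IsLead hϖ h (c m - a m) x := hx
    have h3 := h1.sub h2
    rw [sub_self, isLead_zero_iff] at h3
    rw [level_self]
    convert h3 using 1
    ring
  · have h1 := hy ⟨l, hl⟩
    rw [twist_of_ne _ _ hl, shift_of_ne _ _ hl, level_succ hh, level_of_ne hl]
    convert neg_mem h1 using 1
    ring

lemma twist_shift_injective (hh : 1 ≤ h) {a : ZMod n → Big p O R}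
    (hu : IsUnit (res (a (m : ZMod n)))) {y y' : {l : ZMod n // l ≠ m} → R} {t t' : R}
    (hyt : ∀ l, twist hϖ h m (shift hϖ h a y) t l - twist hϖ h m (shift hϖ h a y') t' l ∈
      fil p O R (level n m (h + 1) l)) : y = y' ∧ t = t' := by
  constructor
  · funext i
    have h1 := hyt i
    rw [twist_of_ne _ _ i.2, twist_of_ne _ _ i.2, shift_of_ne _ _ i.2, shift_of_ne _ _ i.2,
      level_succ hh, level_of_ne i.2, add_sub_add_left_eq_sub] at h1
    exact lead_injective hϖ h1
  · have h1 := hyt m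
    have h2 := isLead_twist_sub (hϖ := hϖ) (h := h) (m := m) (shift hϖ h a y) t
    have h3 := isLead_twist_sub (hϖ := hϖ) (h := h) (m := m) (shift hϖ h a y') t'
    rw [shift_same] at h2 h3
    rw [level_self] at h1
    have h4 := h3.congr (z' := twist hϖ h m (shift hϖ h a y) t m - a m) (by
      rwa [sub_sub_sub_cancel_right])
    exact (hu.pow _).mul_left_cancel (h2.unique h4)

/-- Writing the obstruction as `N ^ p ^ s * f` lets the unit `N ^ p ^ s` cancel, leaving a monic
equation in `t`. -/
lemma frob_det_twist_mem_iff [NeZero n] (hh : 1 ≤ h) {a : ZMod n → Big p O R} {f : R}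
    (hu : IsUnit (res (a (m : ZMod n)))) (ha : IsLead hϖ h
      (bigFrob p O (lusztigMatrix ϖ n m a).det - (lusztigMatrix ϖ n m a).det)
      (normRes (Nat.card (ResidueField O)) n (res (a (m : ZMod n))) ^ p ^ expo p hϖ h * f))
    (t : R) :
    bigFrob p O (lusztigMatrix ϖ n m (twist hϖ h m a t)).det -
        (lusztigMatrix ϖ n m (twist hϖ h m a t)).det ∈ fil p O R (h + 1) ↔
      t ^ Nat.card (ResidueField O) ^ n - t + f = 0 := by
  have h1 := isLead_frob_det_twist hh ha t
  rw [← mul_add] at h1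
  constructor
  · intro h2
    have h3 := h1.unique (isLead_zero_iff.2 h2)
    rw [((isUnit_normRes _ n hu).pow _).mul_right_eq_zero] at h3
    rwa [add_comm]
  · intro h2
    rwa [add_comm f, h2, mul_zero, isLead_zero_iff] at h1

lemma exists_isLead_frob_det [NeZero n] {a : ZMod n → Big p O R}
    (hu : IsUnit (res (a (m : ZMod n))))
    (ha : bigFrob p O (lusztigMatrix ϖ n m a).det - (lusztigMatrix ϖ n m a).det ∈ fil p O R h) :
    ∃ f, IsLead hϖ h
      (bigFrob p O (lusztigMatrix ϖ n m a).det - (lusztigMatrix ϖ n m a).det)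
      (normRes (Nat.card (ResidueField O)) n (res (a (m : ZMod n))) ^ p ^ expo p hϖ h * f) := by
  obtain ⟨e, he⟩ := exists_lead hϖ ha
  obtain ⟨v, hv⟩ := ((isUnit_normRes (Nat.card (ResidueField O)) n hu).pow
    (p ^ expo p hϖ h)).exists_right_inv
  refine ⟨v * e, ?_⟩
  rw [← mul_assoc, hv, one_mul]
  exact he

end PointLift

/-! ### The coordinate ring of `X̃_{h+1}` as an Artin–Schreier type cover of `X̃_h × 𝔸ⁿ⁻¹` -/

section Succ

variable {p : ℕ} [Fact p.Prime] {O : Type u} [CommRing O] [IsDomain O] [IsDiscreteValuationRing O]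
  [CharP (ResidueField O) p] {ϖ : O}
  [Finite (ResidueField O)] [IsAdicComplete (maximalIdeal O) O]
  {h n : ℕ} {m : ℤ} {Ω : Type u} [Field Ω] [Algebra (ResidueField O) Ω]

namespace CoordRing

variable (Y : CoordRing p O ϖ n m Ω h)

/-- Lifts of the coordinates of the universal point. -/
def lift : ZMod n → Big p O Y.carrier := Y.point.frob_det.choose

lemma mk_lift (l : ZMod n) : Ideal.Quotient.mk _ (Y.lift l) = Y.point.coord l :=
  Y.point.frob_det.choose_spec.1 l

/-- The coordinate ring of `X̃_h × 𝔸ⁿ⁻¹`. -/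
abbrev Aff : Type u := MvPolynomial {l : ZMod n // l ≠ m} Y.carrier

/-- Lifts to level `h + 1` of the coordinates over `X̃_h × 𝔸ⁿ⁻¹`; the determinant condition may
fail for them. -/
def affLift (hϖ : Irreducible ϖ) : ZMod n → Big p O Y.Aff :=
  shift hϖ h (fun l => bigMap p O
    (IsScalarTower.toAlgHom (ResidueField O) Y.carrier Y.Aff) (Y.lift l)) MvPolynomial.X

lemma isUnit_res_lift (hϖ : Irreducible ϖ) (hh : 1 ≤ h) : IsUnit (res (Y.lift (m : ZMod n))) :=
  Y.point.isUnit_res_lift hϖ hh Y.mk_lift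

lemma isUnit_res_affLift (hϖ : Irreducible ϖ) (hh : 1 ≤ h) :
    IsUnit (res (Y.affLift hϖ (m : ZMod n))) := by
  rw [affLift, shift_same, res_bigMap]
  exact (Y.isUnit_res_lift hϖ hh).map _

variable {hϖ : Irreducible ϖ} [NeZero n]

/-- Shifting stays within the truncation ideals of level `h`, so the determinant condition still
holds there; its failure one level higher is a single leading coefficient. -/
lemma exists_const (hϖ : Irreducible ϖ) (hh : 1 ≤ h) : ∃ f : Y.Aff, IsLead hϖ h
      (bigFrob p O (lusztigMatrix ϖ n m (Y.affLift hϖ)).det -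
        (lusztigMatrix ϖ n m (Y.affLift hϖ)).det)
      (normRes (Nat.card (ResidueField O)) n (res (Y.affLift hϖ (m : ZMod n))) ^
        p ^ expo p hϖ h * f) := by
  refine exists_isLead_frob_det (Y.isUnit_res_affLift hϖ hh) ?_
  refine frob_det_mem_of_sub_mem hϖ (shift_sub_mem _ _) ?_
  have := fil_le_comap p O (IsScalarTower.toAlgHom (ResidueField O) Y.carrier Y.Aff) _
    (Y.point.frob_det_mem hϖ Y.mk_lift)
  rwa [Ideal.mem_comap, map_sub, ← bigFrob_bigMap, ← det_lusztigMatrix_bigMap] at this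

/-- The constant coefficient of the Artin–Schreier type polynomial. -/
def const (hϖ : Irreducible ϖ) (hh : 1 ≤ h) : Y.Aff := (Y.exists_const hϖ hh).choose

/-- The Artin–Schreier type polynomial `T ^ qⁿ - T + f`. -/
def poly (hϖ : Irreducible ϖ) (hh : 1 ≤ h) : Polynomial Y.Aff :=
  Polynomial.X ^ Nat.card (ResidueField O) ^ n - Polynomial.X + Polynomial.C (Y.const hϖ hh)

/-- The coordinate ring of `X̃_{h+1}`. -/
abbrev Succ (hϖ : Irreducible ϖ) (hh : 1 ≤ h) : Type u := AdjoinRoot (Y.poly hϖ hh)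

/-- Lifts of the coordinates of the point of `X̃_{h+1}` with given image in `X̃_h` and given additional
coordinates. -/
def coverLift (hϖ : Irreducible ϖ) {R : Type u} [CommRing R] [Algebra (ResidueField O) R]
    (g : Y.carrier →ₐ[ResidueField O] R) (y : {l : ZMod n // l ≠ m} → R) (t : R) :
    ZMod n → Big p O R :=
  twist hϖ h m (shift hϖ h (fun l => bigMap p O g (Y.lift l)) y) t

variable {R : Type u} [CommRing R] [Algebra (ResidueField O) R]
variable {S : Type u} [CommRing S] [Algebra (ResidueField O) S]

omit [NeZero n] in
lemma bigMap_coverLift (f : R →ₐ[ResidueField O] S) (g : Y.carrier →ₐ[ResidueField O] R)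
    (y : {l : ZMod n // l ≠ m} → R) (t : R) (l : ZMod n) :
    bigMap p O f (Y.coverLift hϖ g y t l) =
      Y.coverLift hϖ (f.comp g) (fun i => f (y i)) (f t) l := by
  rw [coverLift, bigMap_twist]
  simp only [bigMap_shift, bigMap_comp, coverLift]

/-- The obstruction is computed once over `X̃_h × 𝔸ⁿ⁻¹` and then specialized along `g`, since
leading coefficients are compatible with `bigMap`. -/
lemma coverLift_frob_iff (hh : 1 ≤ h) (g : Y.Aff →ₐ[ResidueField O] R) (t : R) :
    bigFrob p O (lusztigMatrix ϖ n m (Y.coverLift hϖ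
      (g.comp (IsScalarTower.toAlgHom (ResidueField O) Y.carrier Y.Aff))
      (fun i => g (MvPolynomial.X i)) t)).det -
        (lusztigMatrix ϖ n m (Y.coverLift hϖ
      (g.comp (IsScalarTower.toAlgHom (ResidueField O) Y.carrier Y.Aff))
      (fun i => g (MvPolynomial.X i)) t)).det ∈ fil p O R (h + 1) ↔
      t ^ Nat.card (ResidueField O) ^ n - t + g (Y.const hϖ hh) = 0 := by
  have h1 : shift hϖ h (fun l => bigMap p O
      (g.comp (IsScalarTower.toAlgHom (ResidueField O) Y.carrier Y.Aff)) (Y.lift l))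
      (fun i => g (MvPolynomial.X i)) = fun l => bigMap p O g (Y.affLift hϖ l) := by
    funext l
    rw [affLift, bigMap_shift]
    simp only [bigMap_comp]
  rw [coverLift, h1]
  have h2 := (Y.exists_const hϖ hh).choose_spec.bigMap g
  refine frob_det_twist_mem_iff hh (f := g (Y.const hϖ hh)) ?_ ?_ t
  · rw [res_bigMap]
    exact (Y.isUnit_res_affLift hϖ hh).map _
  · rw [map_mul, map_pow, ← RingHom.coe_coe g, map_normRes, RingHom.coe_coe, ← res_bigMap,
      map_sub, ← bigFrob_bigMap, ← det_lusztigMatrix_bigMap] at h2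
    exact h2

/-- The point of `X̃_{h+1}` with given image in `X̃_h × 𝔸ⁿ⁻¹`. -/
def coverPoint (hϖ : Irreducible ϖ) (hh : 1 ≤ h) (g : Y.Aff →ₐ[ResidueField O] R) (t : R)
    (ht : t ^ Nat.card (ResidueField O) ^ n - t + g (Y.const hϖ hh) = 0) :
    Point p O ϖ n m (h + 1) R :=
  Point.ofLift hϖ (Nat.succ_pos h) (Y.coverLift hϖ
      (g.comp (IsScalarTower.toAlgHom (ResidueField O) Y.carrier Y.Aff))
      (fun i => g (MvPolynomial.X i)) t) (by
    have h1 : res (lead (p := p) hϖ h t) = 0 :=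
      res_eq_zero_of_mem (fil_anti p O hh (lead_mem_fil hϖ h t))
    rw [coverLift, twist_same, map_mul, map_add, map_one, h1, add_zero, mul_one, shift_same,
      res_bigMap]
    exact (Y.isUnit_res_lift hϖ hh).map _) ((Y.coverLift_frob_iff hh g t).2 ht)

lemma coverPoint_map (hh : 1 ≤ h) (g : Y.Aff →ₐ[ResidueField O] R) (t : R)
    (ht : t ^ Nat.card (ResidueField O) ^ n - t + g (Y.const hϖ hh) = 0)
    (f : R →ₐ[ResidueField O] S) :
    (Y.coverPoint hϖ hh g t ht).map f = Y.coverPoint hϖ hh (f.comp g) (f t) (by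
      rw [AlgHom.comp_apply, ← map_pow, ← map_sub, ← map_add, ht, map_zero]) := by
  refine Point.ext (funext fun l => ?_)
  change Ideal.Quotient.mk _ (bigMap p O f (Y.coverLift hϖ _ _ _ l)) = Ideal.Quotient.mk _ _
  rw [bigMap_coverLift]
  rfl

lemma coverPoint_red (hh : 1 ≤ h) (g : Y.Aff →ₐ[ResidueField O] R) (t : R)
    (ht : t ^ Nat.card (ResidueField O) ^ n - t + g (Y.const hϖ hh) = 0) :
    (Y.coverPoint hϖ hh g t ht).red (Nat.le_succ h) = Y.point.map
      (g.comp (IsScalarTower.toAlgHom (ResidueField O) Y.carrier Y.Aff)) := by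
  refine Point.ext (funext fun l => ?_)
  change Ideal.Quotient.mk _ (Y.coverLift hϖ _ _ _ l) = okMap p O _ _ (Y.point.coord l)
  rw [← mk_lift]
  change _ = Ideal.Quotient.mk _ (bigMap p O _ _)
  rw [Ideal.Quotient.eq, coverLift]
  have h1 := twist_sub_mem (hϖ := hϖ) (h := h) (m := m) (shift hϖ h (fun l => bigMap p O
      (g.comp (IsScalarTower.toAlgHom (ResidueField O) Y.carrier Y.Aff)) (Y.lift l))
      (fun i => g (MvPolynomial.X i))) t l
  have h2 := shift_sub_mem (hϖ := hϖ) (h := h) (m := m) (fun l => bigMap p O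
      (g.comp (IsScalarTower.toAlgHom (ResidueField O) Y.carrier Y.Aff)) (Y.lift l))
      (fun i => g (MvPolynomial.X i)) l
  have h3 := add_mem (fil_anti p O (level_le n m h l) h1) h2
  rwa [sub_add_sub_cancel] at h3

variable [Algebra Ω R] [IsScalarTower (ResidueField O) Ω R]

/-- A point of `X̃_{h+1}` is given by a point of `X̃_h × 𝔸ⁿ⁻¹` and a root of the polynomial. -/
lemma coverPoint_injective (hh : 1 ≤ h) {g g' : Y.Aff →ₐ[Ω] R} {t t' : R}
    (ht : t ^ Nat.card (ResidueField O) ^ n - t + g (Y.const hϖ hh) = 0)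
    (ht' : t' ^ Nat.card (ResidueField O) ^ n - t' + g' (Y.const hϖ hh) = 0)
    (H : Y.coverPoint hϖ hh (g.restrictScalars (ResidueField O)) t ht =
      Y.coverPoint hϖ hh (g'.restrictScalars (ResidueField O)) t' ht') : g = g' ∧ t = t' := by
  -- Reduction to level `h` determines `g` on `Y.carrier` by the universal property; once the base
  -- lifts agree, the values of the variables and `t` are determined as leading coefficients.
  have h1 := (Y.coverPoint_red hh _ t ht).symm.trans
    ((congrArg (fun x => x.red (Nat.le_succ h)) H).trans (Y.coverPoint_red hh _ t' ht'))
  have h2 : g.comp (IsScalarTower.toAlgHom Ω Y.carrier Y.Aff) =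
      g'.comp (IsScalarTower.toAlgHom Ω Y.carrier Y.Aff) := (Y.universal R).1 h1
  have h2' : (g.restrictScalars (ResidueField O)).comp
      (IsScalarTower.toAlgHom (ResidueField O) Y.carrier Y.Aff) =
      (g'.restrictScalars (ResidueField O)).comp
        (IsScalarTower.toAlgHom (ResidueField O) Y.carrier Y.Aff) :=
    AlgHom.ext fun b => AlgHom.congr_fun h2 b
  have h3 : ∀ l, Y.coverLift hϖ _ _ _ l - Y.coverLift hϖ _ _ _ l ∈ fil p O R _ :=
    fun l => Ideal.Quotient.eq.1 (congrFun (congrArg Point.coord H) l)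
  rw [h2'] at h3
  obtain ⟨h4, h5⟩ := twist_shift_injective hh (by
    rw [res_bigMap]; exact (Y.isUnit_res_lift hϖ hh).map _) h3
  refine ⟨AlgHom.coe_ringHom_injective (MvPolynomial.ringHom_ext (fun b => ?_)
    fun i => congrFun h4 i), h5⟩
  exact AlgHom.congr_fun h2 b

/-- The reduction of `x` gives a map out of `Y.carrier`. Comparing the transported lifts with lifts
of `x` gives the values of the variables and `t`, and the determinant condition on `x` becomes the
root equation. -/
lemma coverPoint_surjective (hϖ : Irreducible ϖ) (hh : 1 ≤ h) (x : Point p O ϖ n m (h + 1) R) :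
    ∃ (g : Y.Aff →ₐ[Ω] R) (t : R)
      (ht : t ^ Nat.card (ResidueField O) ^ n - t + g (Y.const hϖ hh) = 0),
      Y.coverPoint hϖ hh (g.restrictScalars (ResidueField O)) t ht = x := by
  obtain ⟨g, hg⟩ := (Y.universal R).2 (x.red (Nat.le_succ h))
  obtain ⟨c, hc, -⟩ := x.frob_det
  have h1 : ∀ l, c l - bigMap p O (g.restrictScalars (ResidueField O)) (Y.lift l) ∈
      fil p O R (level n m h l) := by
    intro l
    have h2 := congrFun (congrArg Point.coord hg) l
    change okMap p O _ _ (Y.point.coord l) = okRed p O _ (x.coord l) at h2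
    rw [← hc, ← mk_lift] at h2
    exact Ideal.Quotient.eq.1 h2.symm
  obtain ⟨y, t, hyt⟩ := exists_twist_shift (hϖ := hϖ) hh (by
    rw [res_bigMap]; exact (Y.isUnit_res_lift hϖ hh).map _) h1
  let g' : Y.Aff →ₐ[Ω] R :=
    { MvPolynomial.eval₂Hom (g : Y.carrier →+* R) y with
      commutes' := fun r => by
        rw [IsScalarTower.algebraMap_apply Ω Y.carrier Y.Aff]
        change MvPolynomial.eval₂Hom (g : Y.carrier →+* R) y (MvPolynomial.C _) = _
        rw [MvPolynomial.eval₂Hom_C]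
        exact g.commutes r }
  have hg1 : ∀ i, g' (MvPolynomial.X i) = y i := fun i => MvPolynomial.eval₂Hom_X' _ _ _
  have hg2 : (g'.restrictScalars (ResidueField O)).comp
      (IsScalarTower.toAlgHom (ResidueField O) Y.carrier Y.Aff) =
      g.restrictScalars (ResidueField O) :=
    AlgHom.ext fun b => MvPolynomial.eval₂Hom_C _ _ _
  have hlift : Y.coverLift hϖ ((g'.restrictScalars (ResidueField O)).comp
      (IsScalarTower.toAlgHom (ResidueField O) Y.carrier Y.Aff))
      (fun i => g'.restrictScalars (ResidueField O) (MvPolynomial.X i)) t =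
      twist hϖ h m (shift hϖ h
        (fun l => bigMap p O (g.restrictScalars (ResidueField O)) (Y.lift l)) y) t := by
    rw [hg2, coverLift]
    congr 2
    funext i
    exact hg1 i
  refine ⟨g', t, (Y.coverLift_frob_iff hh (g'.restrictScalars (ResidueField O)) t).1 ?_, ?_⟩
  · rw [hlift]
    exact frob_det_mem_of_sub_mem hϖ hyt (x.frob_det_mem hϖ hc)
  · refine Point.ext (funext fun l => ?_)
    change Ideal.Quotient.mk _ (Y.coverLift hϖ _ _ _ l) = _
    rw [hlift, ← hc]
    exact Ideal.Quotient.eq.2 (hyt l)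

lemma root_pow_eq (hϖ : Irreducible ϖ) (hh : 1 ≤ h) :
    AdjoinRoot.root (Y.poly hϖ hh) ^ Nat.card (ResidueField O) ^ n -
      AdjoinRoot.root (Y.poly hϖ hh) +
      (IsScalarTower.toAlgHom (ResidueField O) Y.Aff (Y.Succ hϖ hh)) (Y.const hϖ hh) = 0 := by
  have h1 := AdjoinRoot.eval₂_root (Y.poly hϖ hh)
  rw [poly, Polynomial.eval₂_add, Polynomial.eval₂_sub, Polynomial.eval₂_pow,
    Polynomial.eval₂_X, Polynomial.eval₂_C] at h1
  exact h1

/-- The scheme `X̃_{h+1}` as a cover of `X̃_h × 𝔸ⁿ⁻¹`. -/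
@[reducible] def succ (hϖ : Irreducible ϖ) (hh : 1 ≤ h) : CoordRing p O ϖ n m Ω (h + 1) where
  carrier := Y.Succ hϖ hh
  point := Y.coverPoint hϖ hh (IsScalarTower.toAlgHom (ResidueField O) Y.Aff (Y.Succ hϖ hh))
    (AdjoinRoot.root (Y.poly hϖ hh)) (Y.root_pow_eq hϖ hh)
  universal R _ _ _ _ := by
    constructor
    · intro f f' hff
      simp only [coverPoint_map] at hff
      have h1 := Y.coverPoint_injective hh
        (g := f.comp (IsScalarTower.toAlgHom Ω Y.Aff (Y.Succ hϖ hh)))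
        (g' := f'.comp (IsScalarTower.toAlgHom Ω Y.Aff (Y.Succ hϖ hh))) _ _ hff
      refine AlgHom.coe_ringHom_injective (AdjoinRoot.ringHom_ext ?_ h1.2)
      exact RingHom.ext fun c => AlgHom.congr_fun h1.1 c
    · intro x
      obtain ⟨g, t, ht, rfl⟩ := Y.coverPoint_surjective hϖ hh x
      have hroot : (Y.poly hϖ hh).eval₂ (g : Y.Aff →+* R) t = 0 := by
        rw [poly, Polynomial.eval₂_add, Polynomial.eval₂_sub, Polynomial.eval₂_pow,
          Polynomial.eval₂_X, Polynomial.eval₂_C]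
        exact ht
      refine ⟨{ AdjoinRoot.lift (g : Y.Aff →+* R) t hroot with
        commutes' := fun r => ?_ }, ?_⟩
      · rw [IsScalarTower.algebraMap_apply Ω Y.Aff (Y.Succ hϖ hh)]
        change AdjoinRoot.lift (g : Y.Aff →+* R) t hroot (AdjoinRoot.of _ _) = _
        rw [AdjoinRoot.lift_of]
        exact g.commutes r
      · simp only [coverPoint_map]
        congr 1
        · exact AlgHom.ext fun c => AdjoinRoot.lift_of hroot
        · exact AdjoinRoot.lift_root hroot

end CoordRing

end Succ

/-! ### Existence of the coordinate rings -/

section Existence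

variable {p : ℕ} [Fact p.Prime] {O : Type u} [CommRing O] [IsDomain O] [IsDiscreteValuationRing O]
  [CharP (ResidueField O) p] {ϖ : O}
  [Finite (ResidueField O)] [IsAdicComplete (maximalIdeal O) O]
  {h n : ℕ} {m : ℤ} {Ω : Type u} [Field Ω] [Algebra (ResidueField O) Ω] [NeZero n]

lemma res_lead_zero (hϖ : Irreducible ϖ) {R : Type u} [CommRing R] [Algebra (ResidueField O) R]
    (x : R) : res (lead (p := p) hϖ 0 x) = x := by
  rw [lead_zero_eq, res_tmul, map_one, map_one, one_mul, WittVector.teichmuller_coeff_zero]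

/-- At level `1` the condition is `N ^ q = N` for the norm `N` of `u = res (a m)`. Multiplying by
the unit `u` and cancelling `N` turns it into `u ^ q ^ n = u`. -/
lemma frob_det_mem_one_iff (hϖ : Irreducible ϖ) {R : Type u} [CommRing R]
    [Algebra (ResidueField O) R] {a : ZMod n → Big p O R} (hu : IsUnit (res (a (m : ZMod n)))) :
    bigFrob p O (lusztigMatrix ϖ n m a).det - (lusztigMatrix ϖ n m a).det ∈ fil p O R 1 ↔
      res (a (m : ZMod n)) ^ (Nat.card (ResidueField O) ^ n - 1) = 1 := by
  rw [mem_fil_one_iff hϖ, map_sub, res_bigFrob, res_det ((mem_maximalIdeal ϖ).2 hϖ.not_isUnit),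
    sub_eq_zero, ← hu.mul_left_inj, normRes_pow_mul, (isUnit_normRes _ n hu).mul_right_inj]
  have h1 : 1 ≤ Nat.card (ResidueField O) ^ n := Nat.one_le_pow _ _ Nat.card_pos
  conv_lhs => rw [← Nat.sub_add_cancel h1, pow_succ]
  nth_rw 3 [← one_mul (res (a (m : ZMod n)))]
  rw [hu.mul_left_inj]

/-- The scheme `X̃_1`: it is the scheme of `(qⁿ - 1)`-th roots of unity. -/
def CoordRing.one (hϖ : Irreducible ϖ) : CoordRing p O ϖ n m Ω 1 where
  carrier := AdjoinRoot (Polynomial.X ^ (Nat.card (ResidueField O) ^ n - 1) - 1 :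
    Polynomial Ω)
  -- The lifts at `l ≠ m` are immaterial: those coordinates live at level `0`, where `OK` is the
  -- zero ring.
  point := Point.ofLift hϖ le_rfl (fun _ => lead hϖ 0 (AdjoinRoot.root _)) (by
      rw [res_lead_zero]
      have h1 := AdjoinRoot.eval₂_root (Polynomial.X ^ (Nat.card (ResidueField O) ^ n - 1) - 1 :
        Polynomial Ω)
      rw [Polynomial.eval₂_sub, Polynomial.eval₂_pow, Polynomial.eval₂_X, Polynomial.eval₂_one,
        sub_eq_zero] at h1
      by_cases h0 : Nat.card (ResidueField O) ^ n - 1 = 0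
      · have h2 : 2 ≤ Nat.card (ResidueField O) := Finite.one_lt_card
        have h3 := Nat.le_self_pow (NeZero.ne n) (Nat.card (ResidueField O))
        omega
      · exact IsUnit.of_pow_eq_one h1 h0) (by
      have h1 := AdjoinRoot.eval₂_root (Polynomial.X ^ (Nat.card (ResidueField O) ^ n - 1) - 1 :
        Polynomial Ω)
      rw [Polynomial.eval₂_sub, Polynomial.eval₂_pow, Polynomial.eval₂_X, Polynomial.eval₂_one,
        sub_eq_zero] at h1
      have h2 : 2 ≤ Nat.card (ResidueField O) := Finite.one_lt_card
      have h3 := Nat.le_self_pow (NeZero.ne n) (Nat.card (ResidueField O))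
      rw [frob_det_mem_one_iff hϖ]
      · rw [res_lead_zero]; exact h1
      · rw [res_lead_zero]; exact IsUnit.of_pow_eq_one h1 (by omega))
  universal R _ _ _ _ := by
    constructor
    · intro f f' hff
      have h1 := congrFun (congrArg Point.coord hff) m
      change Ideal.Quotient.mk _ (bigMap p O _ (lead hϖ 0 _)) =
        Ideal.Quotient.mk _ (bigMap p O _ (lead hϖ 0 _)) at h1
      rw [bigMap_lead, bigMap_lead, Ideal.Quotient.eq, level_self] at h1
      exact AdjoinRoot.algHom_ext (lead_injective hϖ h1)
    · intro x
      obtain ⟨c, hc, hdet⟩ := x.frob_det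
      have hu := x.isUnit_res_lift hϖ le_rfl hc
      rw [frob_det_mem_one_iff hϖ hu] at hdet
      have hroot : (Polynomial.X ^ (Nat.card (ResidueField O) ^ n - 1) - 1 : Polynomial Ω).eval₂
          (Algebra.ofId Ω R : Ω →+* R) (res (c (m : ZMod n))) = 0 := by
        rw [Polynomial.eval₂_sub, Polynomial.eval₂_pow, Polynomial.eval₂_X, Polynomial.eval₂_one,
          hdet, sub_self]
      refine ⟨AdjoinRoot.liftAlgHom _ (Algebra.ofId Ω R) _ hroot, ?_⟩
      refine Point.ext (funext fun l => ?_)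
      change Ideal.Quotient.mk _ (bigMap p O _ (lead hϖ 0 _)) = _
      rw [bigMap_lead, ← hc, Ideal.Quotient.eq]
      change lead hϖ 0 (AdjoinRoot.liftAlgHom _ (Algebra.ofId Ω R) _ hroot (AdjoinRoot.root _)) -
        _ ∈ _
      rw [AdjoinRoot.liftAlgHom_root]
      by_cases hl : l = m
      · subst hl
        rw [level_self]
        have := neg_mem (isLead_res hϖ (c m))
        rwa [neg_sub] at this
      · rw [level_of_ne hl, fil_zero]
        trivial

variable (p n m Ω) in
theorem exists_coordRing (hϖ : Irreducible ϖ) (h : ℕ) (hh : 1 ≤ h) :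
    ∃ X : CoordRing p O ϖ n m Ω h, Algebra.FiniteType Ω X.carrier := by
  induction h, hh using Nat.le_induction with
  | base =>
    refine ⟨CoordRing.one hϖ, ?_⟩
    exact (inferInstance : Algebra.FiniteType Ω (AdjoinRoot
      (Polynomial.X ^ (Nat.card (ResidueField O) ^ n - 1) - 1 : Polynomial Ω)))
  | succ h hh ih =>
    obtain ⟨Y, hY⟩ := ih
    refine ⟨Y.succ hϖ hh, ?_⟩
    have h1 : Algebra.FiniteType Y.carrier Y.Aff := inferInstance
    have h2 : Algebra.FiniteType Y.Aff (Y.Succ hϖ hh) := inferInstance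
    exact ((hY.trans h1).trans h2 : Algebra.FiniteType Ω (Y.Succ hϖ hh))

end Existence

/-! ### Invariants under translations of the root -/

section Translation

open Polynomial

lemma adjoinRoot_of_injective {B : Type*} [CommRing B] {f : B[X]} (hf : f.Monic)
    (hd : 0 < f.natDegree) : Function.Injective (AdjoinRoot.of f) := by
  rw [injective_iff_map_eq_zero]
  intro b hb
  have h1 : AdjoinRoot.mk f (C b) = 0 := hb
  rw [AdjoinRoot.mk_eq_zero] at h1
  by_contra h0
  exact hf.not_dvd_of_natDegree_lt (C_ne_zero.2 h0) (by rwa [natDegree_C]) h1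

/-- An element of `B[T]/(f)` is constant if it is invariant under `deg f` translations of `T`. -/
lemma mem_range_of_of_translation {k B : Type*} [Field k] [CommRing B] [Algebra k B] {f : B[X]}
    (hf : f.Monic) (hd : 0 < f.natDegree) (s : Finset k) (hs : f.natDegree ≤ s.card)
    (a : AdjoinRoot f)
    (ha : ∀ c ∈ s, ∃ θ : AdjoinRoot f →+* AdjoinRoot f, (∀ b, θ (AdjoinRoot.of f b) =
      AdjoinRoot.of f b) ∧ θ (AdjoinRoot.root f) =
        AdjoinRoot.root f + AdjoinRoot.of f (algebraMap k B c) ∧ θ a = a) :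
    ∃ b, AdjoinRoot.of f b = a := by
  rcases subsingleton_or_nontrivial B with hB | hB
  · have : Subsingleton (AdjoinRoot f) := (AdjoinRoot.mk_surjective (g := f)).subsingleton
    exact ⟨0, Subsingleton.elim _ _⟩
  obtain ⟨P₀, rfl⟩ := AdjoinRoot.mk_surjective a
  set P := P₀ %ₘ f
  have hP : AdjoinRoot.mk f P₀ = AdjoinRoot.mk f P := by
    rw [AdjoinRoot.mk_eq_mk]
    exact ⟨P₀ /ₘ f, sub_eq_of_eq_add' (modByMonic_add_div P₀ f).symm⟩
  have hPd : P.natDegree < f.natDegree :=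
    natDegree_modByMonic_lt P₀ hf (fun h => by rw [h, natDegree_one] at hd; exact hd.false)
  rw [hP] at ha ⊢
  -- Translation preserves the bound `natDegree < natDegree f`, so invariance of the class of `P` is
  -- the polynomial identity `P(X + c) = P(X)`; evaluating at `0` gives `P(c) = P(0)`.
  have hroot : ∀ c ∈ s, (X - C (algebraMap k B c)) ∣ P - C (P.eval 0) := by
    intro c hc
    obtain ⟨θ, hθ1, hθ2, hθ3⟩ := ha c hc
    have h1 : ∀ q : B[X], θ (AdjoinRoot.mk f q) =
        AdjoinRoot.mk f (q.comp (X + C (algebraMap k B c))) := by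
      intro q
      have h2 : θ.comp (AdjoinRoot.mk f) =
          (AdjoinRoot.mk f).comp (compRingHom (X + C (algebraMap k B c))) := by
        refine Polynomial.ringHom_ext (fun b => ?_) ?_
        · simpa using hθ1 b
        · simpa using hθ2
      exact RingHom.congr_fun h2 q
    rw [h1, AdjoinRoot.mk_eq_mk] at hθ3
    have h3 : P.comp (X + C (algebraMap k B c)) = P := by
      rw [← sub_eq_zero]
      by_contra h0
      refine hf.not_dvd_of_natDegree_lt h0 (lt_of_le_of_lt (natDegree_sub_le _ _) ?_) hθ3
      refine max_lt (lt_of_le_of_lt natDegree_comp_le ?_) hPd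
      rwa [natDegree_X_add_C, mul_one]
    rw [dvd_iff_isRoot, IsRoot, eval_sub, eval_C, sub_eq_zero]
    conv_rhs => rw [← h3]
    simp
  -- The ring `B` need not be a domain, but distinct `c` come from a field, so their differences are
  -- units and the factors `X - c` are pairwise coprime.
  have hdvd : ∏ c ∈ s, (X - C (algebraMap k B c)) ∣ P - C (P.eval 0) := by
    refine Finset.prod_dvd_of_coprime (fun c _ d _ hcd => ?_) hroot
    refine isCoprime_X_sub_C_of_isUnit_sub ?_
    rw [← map_sub]
    exact (IsUnit.mk0 _ (sub_ne_zero.2 hcd)).map _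
  have hm : (∏ c ∈ s, (X - C (algebraMap k B c))).Monic :=
    monic_prod_of_monic _ _ fun c _ => monic_X_sub_C _
  have h0 : P - C (P.eval 0) = 0 := by
    by_contra h0
    refine hm.not_dvd_of_natDegree_lt h0 ?_ hdvd
    rw [natDegree_prod_of_monic _ _ fun c _ => monic_X_sub_C _]
    simp only [natDegree_X_sub_C, Finset.sum_const, smul_eq_mul, mul_one]
    refine lt_of_le_of_lt (natDegree_sub_le _ _) (lt_of_lt_of_le ?_ hs)
    rw [natDegree_C]
    exact max_lt hPd hd
  exact ⟨P.eval 0, (congrArg (AdjoinRoot.mk f) (sub_eq_zero.1 h0)).symm⟩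

end Translation

/-! ### The `qⁿ` roots of `X ^ qⁿ - X` in `Ω` -/

section FiniteField

lemma exists_finset_pow_card_pow_eq (k : Type u) [Field k] [Finite k] (p : ℕ) [Fact p.Prime]
    [CharP k p] (Ω : Type u) [Field Ω] [Algebra k Ω] [IsAlgClosed Ω] (n : ℕ) [NeZero n] :
    ∃ s : Finset Ω, s.card = Nat.card k ^ n ∧ ∀ c ∈ s, c ^ Nat.card k ^ n = c := by
  classical
  have hp : p ∣ Nat.card k ^ n := by
    refine dvd_pow ?_ (NeZero.ne n)
    have := Fintype.ofFinite k
    rw [Nat.card_eq_fintype_card, ← CharP.cast_eq_zero_iff k p]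
    exact FiniteField.cast_card_eq_zero k
  have h1 : 1 < Nat.card k ^ n := Nat.one_lt_pow (NeZero.ne n) Finite.one_lt_card
  have : CharP Ω p := charP_of_injective_algebraMap (algebraMap k Ω).injective p
  set f : Polynomial Ω := Polynomial.X ^ Nat.card k ^ n - Polynomial.X
  have h2 := Polynomial.card_rootSet_eq_natDegree (K := Ω)
    (galois_poly_separable (K := Ω) p _ hp) (IsAlgClosed.splits_domain _)
  rw [FiniteField.X_pow_card_sub_X_natDegree_eq Ω h1] at h2
  refine ⟨(f.rootSet Ω).toFinset, by rw [Set.toFinset_card]; exact h2, fun c hc => ?_⟩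
  rw [Set.mem_toFinset, Polynomial.mem_rootSet'] at hc
  simpa [f, sub_eq_zero] using hc.2

end FiniteField

/-! ### Functoriality of points and uniqueness of coordinate rings -/

section Action

variable {p : ℕ} [Fact p.Prime] {O : Type u} [CommRing O] [IsLocalRing O]
  [CharP (ResidueField O) p] {ϖ : O}
  [Finite (ResidueField O)] [IsAdicComplete (maximalIdeal O) O]
  {h n : ℕ} {m : ℤ} {Ω : Type u} [Field Ω] [Algebra (ResidueField O) Ω]
  {R : Type u} [CommRing R] [Algebra (ResidueField O) R]
  {S : Type u} [CommRing S] [Algebra (ResidueField O) S]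
  {T : Type u} [CommRing T] [Algebra (ResidueField O) T]

omit [IsAdicComplete (maximalIdeal O) O] in
lemma mem_Fqn_iff {x : Ω} : x ∈ Fqn O n Ω ↔ x ^ Nat.card (ResidueField O) ^ n = x := by
  have h1 : ∀ i : ℕ, (frobHom (ResidueField O) Ω ^ i) x = x ^ Nat.card (ResidueField O) ^ i := by
    intro i
    induction i with
    | zero => simp
    | succ i ih => rw [pow_succ', AlgHom.mul_apply, ih, frobHom_apply, ← pow_mul, pow_succ]
  rw [← h1]
  rfl

lemma okMap_mk (f : R →ₐ[ResidueField O] S) (a : Big p O R) :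
    okMap p O f h (Ideal.Quotient.mk _ a) = Ideal.Quotient.mk _ (bigMap p O f a) := rfl

lemma Point.map_map (x : Point p O ϖ n m h R) (f : R →ₐ[ResidueField O] S)
    (g : S →ₐ[ResidueField O] T) : (x.map f).map g = x.map (g.comp f) := by
  refine Point.ext (funext fun l => ?_)
  change okMap p O g _ (okMap p O f _ (x.coord l)) = okMap p O (g.comp f) _ (x.coord l)
  obtain ⟨a, ha⟩ := Ideal.Quotient.mk_surjective (x.coord l)
  rw [← ha, okMap_mk, okMap_mk, okMap_mk, bigMap_comp]

lemma Point.map_id (x : Point p O ϖ n m h R) : x.map (AlgHom.id _ R) = x := by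
  refine Point.ext (funext fun l => ?_)
  change okMap p O _ _ (x.coord l) = x.coord l
  obtain ⟨a, ha⟩ := Ideal.Quotient.mk_surjective (x.coord l)
  rw [← ha, okMap_mk, bigMap_id]

lemma Point.red_map {i j : ℕ} (hij : i ≤ j) (x : Point p O ϖ n m j R)
    (f : R →ₐ[ResidueField O] S) : (x.map f).red hij = (x.red hij).map f := by
  refine Point.ext (funext fun l => ?_)
  change okRed p O _ (okMap p O f _ (x.coord l)) = okMap p O f _ (okRed p O _ (x.coord l))
  obtain ⟨a, ha⟩ := Ideal.Quotient.mk_surjective (x.coord l)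
  rw [← ha]
  rfl

variable [Algebra Ω R] [IsScalarTower (ResidueField O) Ω R] [Algebra Ω S]
  [IsScalarTower (ResidueField O) Ω S] [NeZero n]

lemma Point.act_map (hϖ : ϖ ∈ maximalIdeal O) (z : Z p O ϖ n Ω h) (x : Point p O ϖ n m h R)
    (f : R →ₐ[Ω] S) : (x.act hϖ z).map (f.restrictScalars (ResidueField O)) =
      (x.map (f.restrictScalars (ResidueField O))).act hϖ z := by
  refine Point.ext (funext fun l => ?_)
  change okMap p O _ _ (olTo (R := R) (Ω := Ω) (n := n) hϖ (level_le n m h l) z.val * x.coord l) =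
    olTo (R := S) (Ω := Ω) (n := n) hϖ (level_le n m h l) z.val * okMap p O _ _ (x.coord l)
  rw [map_mul]
  congr 1
  obtain ⟨y, hy⟩ := Ideal.Quotient.mk_surjective z.val
  rw [← hy]
  change Ideal.Quotient.mk _ (bigMap p O _ (bigMap p O _ y)) = Ideal.Quotient.mk _ (bigMap p O _ y)
  rw [bigMap_comp]
  have hf : (f.restrictScalars (ResidueField O)).comp (fqnTo O n (Ω := Ω) R) = fqnTo O n S :=
    AlgHom.ext fun x => f.commutes (x : Ω)
  exact congrArg (fun g => Ideal.Quotient.mk _ (bigMap p O g y)) hf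

namespace CoordRing

omit [NeZero n] in
lemma hom_ext (X : CoordRing p O ϖ n m Ω h) {f g : X.carrier →ₐ[Ω] R}
    (hfg : X.point.map (f.restrictScalars (ResidueField O)) =
      X.point.map (g.restrictScalars (ResidueField O))) : f = g :=
  (X.universal R).1 hfg

lemma ofPoint_comp_ofPoint (X X' : CoordRing p O ϖ n m Ω h) :
    (X'.ofPoint X.point).comp (X.ofPoint X'.point) = AlgHom.id Ω X.carrier := by
  apply X.hom_ext
  have h1 := Point.map_map X.point ((X.ofPoint X'.point).restrictScalars (ResidueField O))
    ((X'.ofPoint X.point).restrictScalars (ResidueField O))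
  rw [map_ofPoint, map_ofPoint] at h1
  exact h1.symm.trans (Point.map_id _).symm

/-- Two coordinate rings are canonically isomorphic. -/
def equiv (X X' : CoordRing p O ϖ n m Ω h) : X.carrier ≃ₐ[Ω] X'.carrier :=
  AlgEquiv.ofAlgHom (X.ofPoint X'.point) (X'.ofPoint X.point) (ofPoint_comp_ofPoint X' X)
    (ofPoint_comp_ofPoint X X')

/-- Both composites carry the universal point of `X` to the translate by `z` of that of `X'`.
Invariants can therefore be computed in any model, in particular in `Y.succ`. -/
lemma equiv_actHom (X X' : CoordRing p O ϖ n m Ω h) (hϖ : ϖ ∈ maximalIdeal O)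
    (z : Z p O ϖ n Ω h) (a : X.carrier) :
    X.equiv X' (X.actHom hϖ z a) = X'.actHom hϖ z (X.equiv X' a) := by
  have h1 : (X.ofPoint X'.point).comp (X.actHom hϖ z) =
      (X'.actHom hϖ z).comp (X.ofPoint X'.point) := by
    apply X.hom_ext
    have h2 := Point.map_map X.point ((X.actHom hϖ z).restrictScalars (ResidueField O))
      ((X.ofPoint X'.point).restrictScalars (ResidueField O))
    have h3 := Point.map_map X.point ((X.ofPoint X'.point).restrictScalars (ResidueField O))
      ((X'.actHom hϖ z).restrictScalars (ResidueField O))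
    rw [actHom, map_ofPoint, Point.act_map, map_ofPoint] at h2
    rw [actHom, map_ofPoint, map_ofPoint] at h3
    exact h2.symm.trans h3
  exact AlgHom.congr_fun h1 a

lemma mem_invariants_iff (X : CoordRing p O ϖ n m Ω h) (hϖ : ϖ ∈ maximalIdeal O)
    {a : X.carrier} : a ∈ X.invariants hϖ ↔ ∀ w ∈ W p O ϖ n Ω h, X.actHom hϖ w a = a := by
  simp only [invariants, Algebra.mem_iInf]
  rfl

end CoordRing

end Action

/-! ### The action of `W_{h+1}` on `X̃_{h+1}` and its invariants -/

section CoverAction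

lemma add_pow_card_pow (k : Type u) [Field k] [Finite k] {R : Type u} [CommRing R] [Algebra k R]
    (x y : R) (i : ℕ) :
    (x + y) ^ Nat.card k ^ i = x ^ Nat.card k ^ i + y ^ Nat.card k ^ i := by
  induction i with
  | zero => simp
  | succ i ih =>
    rw [pow_succ, pow_mul, ih, ← frobHom_apply k R, map_add, frobHom_apply, frobHom_apply,
      ← pow_mul, ← pow_mul]

variable {p : ℕ} [Fact p.Prime] {O : Type u} [CommRing O] [IsDomain O] [IsDiscreteValuationRing O]
  [CharP (ResidueField O) p] {ϖ : O}
  [Finite (ResidueField O)] [IsAdicComplete (maximalIdeal O) O]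
  {h n : ℕ} {m : ℤ} {Ω : Type u} [Field Ω] [Algebra (ResidueField O) Ω]
  {hϖ : Irreducible ϖ} {hϖ' : ϖ ∈ maximalIdeal O}

/-- The element `z = 1 + ϖʰ y` of `Z_{h+1}`. -/
def IsOneAdd (h : ℕ) (z : Z p O ϖ n Ω (h + 1)) (y : OL p O n Ω) : Prop :=
  z.val = Ideal.Quotient.mk _ (1 + algebraMap O (OL p O n Ω) ϖ ^ h * y)

lemma exists_isOneAdd_of_mem_W {z : Z p O ϖ n Ω (h + 1)} (hz : z ∈ W p O ϖ n Ω (h + 1)) :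
    ∃ y, IsOneAdd h z y := by
  obtain ⟨a, ha⟩ := Ideal.Quotient.mk_surjective z.val
  have h1 : (zRed p O ϖ n Ω (Nat.sub_le (h + 1) 1) z).val = 1 := by
    rw [MonoidHom.mem_ker.1 hz]; rfl
  have h2 : Ideal.Quotient.factor (Ideal.span_singleton_le_span_singleton.mpr
      (pow_dvd_pow (algebraMap O (OL p O n Ω) ϖ) (Nat.sub_le (h + 1) 1))) z.val = 1 := h1
  rw [← ha, Ideal.Quotient.factor_mk, ← map_one (Ideal.Quotient.mk _), Ideal.Quotient.eq,
    Ideal.mem_span_singleton] at h2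
  obtain ⟨y, hy⟩ := h2
  refine ⟨y, ?_⟩
  rw [IsOneAdd, ← ha]
  congr 1
  exact sub_eq_iff_eq_add'.1 hy

/-- The element `ϖ ^ h * y` has square zero modulo `ϖ ^ (h + 1)` because `h ≥ 1`, so adding `1`
gives a unit. -/
lemma exists_mem_W (hh : 1 ≤ h) (y : OL p O n Ω) :
    ∃ z ∈ W p O ϖ n Ω (h + 1), IsOneAdd h z y := by
  set I : Ideal (OL p O n Ω) := Ideal.span {algebraMap O (OL p O n Ω) ϖ ^ (h + 1)}
  have h1 : IsNilpotent (Ideal.Quotient.mk I (algebraMap O (OL p O n Ω) ϖ ^ h * y)) := by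
    refine ⟨2, ?_⟩
    rw [← map_pow, Ideal.Quotient.eq_zero_iff_mem, Ideal.mem_span_singleton, mul_pow, ← pow_mul]
    exact (pow_dvd_pow _ (by omega)).mul_right _
  have h2 : IsUnit (Ideal.Quotient.mk I (1 + algebraMap O (OL p O n Ω) ϖ ^ h * y)) := by
    rw [map_add, map_one]
    exact h1.isUnit_one_add
  obtain ⟨z, hz⟩ := h2
  refine ⟨z, ?_, hz⟩
  refine MonoidHom.mem_ker.2 (Units.ext ?_)
  change Ideal.Quotient.factor (Ideal.span_singleton_le_span_singleton.mpr
      (pow_dvd_pow (algebraMap O (OL p O n Ω) ϖ) (Nat.sub_le (h + 1) 1))) z.val = 1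
  rw [hz, Ideal.Quotient.factor_mk, ← map_one (Ideal.Quotient.mk _), Ideal.Quotient.eq,
    add_sub_cancel_left, Ideal.mem_span_singleton]
  exact dvd_mul_right _ _

/-- The amount by which `1 + ϖʰ y` translates the root. -/
def translation (hϖ : Irreducible ϖ) (h : ℕ) (y : OL p O n Ω) : Ω :=
  ((res y : Fqn O n Ω) : Ω) ^ p ^ expo p hϖ h

lemma translation_pow (y : OL p O n Ω) :
    translation hϖ h y ^ Nat.card (ResidueField O) ^ n = translation hϖ h y := by
  rw [translation, ← pow_mul, mul_comm, pow_mul, mem_Fqn_iff.1 (res y : Fqn O n Ω).2]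

/-- The exponent `p ^ s` in `translation` does no harm: a `p ^ s`-th root of `c` in `Ω` is again
fixed by the `q ^ n`-power map, since Frobenius is injective, and its Teichmüller representative
serves as `y`. -/
lemma exists_translation_eq [IsAlgClosed Ω] {c : Ω}
    (hc : c ^ Nat.card (ResidueField O) ^ n = c) :
    ∃ y : OL p O n Ω, translation hϖ h y = c := by
  have : CharP Ω p := charP_of_injective_algebraMap (algebraMap (ResidueField O) Ω).injective p
  obtain ⟨ζ, hζ⟩ := IsAlgClosed.exists_pow_nat_eq c
    (pow_pos (Nat.Prime.pos (Fact.out : p.Prime)) (expo p hϖ h))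
  have h1 : ζ ∈ Fqn O n Ω := by
    rw [mem_Fqn_iff]
    apply iterateFrobenius_inj Ω p (expo p hϖ h)
    rw [iterateFrobenius_def, iterateFrobenius_def, ← pow_mul, mul_comm, pow_mul, hζ, hc]
  refine ⟨1 ⊗ₜ WittVector.teichmuller p ⟨ζ, h1⟩, ?_⟩
  rw [translation, res_tmul, map_one, map_one, one_mul, WittVector.teichmuller_coeff_zero]
  exact hζ

namespace CoordRing

variable [NeZero n] (Y : CoordRing p O ϖ n m Ω h)
  {R : Type u} [CommRing R] [Algebra (ResidueField O) R]
  [Algebra Ω R] [IsScalarTower (ResidueField O) Ω R]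

/-- At `l ≠ m` the factor `1 + ϖ ^ h v` is trivial modulo `fil h`. At `m`, the product `(1 + ϖ ^ h
v)(1 + lead t)` agrees with `1 + lead (t + c)` modulo `fil (h + 1)`: the leading coefficient of `ϖ ^
h v` is `c = res v ^ p ^ s`, and the cross term lies in `fil (2h)`. -/
lemma coverPoint_act (hh : 1 ≤ h) {z : Z p O ϖ n Ω (h + 1)} {y : OL p O n Ω}
    (hz : IsOneAdd h z y) (g : Y.Aff →ₐ[ResidueField O] R) (t : R)
    (ht : t ^ Nat.card (ResidueField O) ^ n - t + g (Y.const hϖ hh) = 0) :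
    (Y.coverPoint hϖ hh g t ht).act hϖ' z =
      Y.coverPoint hϖ hh g (t + algebraMap Ω R (translation hϖ h y)) (by
        rw [add_pow_card_pow, ← map_pow, translation_pow, add_sub_add_right_eq_sub, ht]) := by
  refine Point.ext (funext fun l => ?_)
  change olTo (R := R) (Ω := Ω) (n := n) hϖ' (level_le n m (h + 1) l) z.val *
    Ideal.Quotient.mk _ (Y.coverLift hϖ _ _ t l) =
    Ideal.Quotient.mk _ (Y.coverLift hϖ _ _ (t + _) l)
  rw [hz]
  set v : Big p O R := bigMap p O (fqnTo O n (Ω := Ω) R) y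
  have hv : bigMap p O (fqnTo O n (Ω := Ω) R) (1 + algebraMap O (OL p O n Ω) ϖ ^ h * y) =
      1 + algebraMap O (Big p O R) ϖ ^ h * v := by
    rw [map_add, map_one, map_mul, map_pow]
    congr 3
    exact (bigMap p O (fqnTo O n (Ω := Ω) R)).commutes ϖ
  change Ideal.Quotient.mk _ (bigMap p O (fqnTo O n (Ω := Ω) R) _) * _ = _
  rw [hv, ← map_mul, Ideal.Quotient.eq]
  have hres : res v ^ p ^ expo p hϖ h = algebraMap Ω R (translation hϖ h y) := by
    rw [res_bigMap, translation, map_pow]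
    rfl
  set c := algebraMap Ω R (translation hϖ h y)
  have hϖh : ∀ w : Big p O R, algebraMap O (Big p O R) ϖ ^ h * w ∈ fil p O R h := fun w => by
    rw [← map_pow]
    exact Ideal.mul_mem_right _ _ (algebraMap_mem_fil p O (Ideal.pow_mem_pow hϖ' h))
  by_cases hl : l = m
  · subst hl
    have h1 : IsLead hϖ h (algebraMap O (Big p O R) ϖ ^ h * v) c := by
      have h2 := isLead_res hϖ v
      rw [IsLead, lead_zero_eq] at h2
      rw [← hres, IsLead, ← pow_tmul_teichmuller]
      have h3 : ((ϖ ^ h) ⊗ₜ (WittVector.teichmuller p (res v)) : Big p O R) =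
          algebraMap O (Big p O R) ϖ ^ h * (1 ⊗ₜ (WittVector.teichmuller p (res v))) := by
        rw [← map_pow, Algebra.TensorProduct.algebraMap_apply,
          Algebra.TensorProduct.tmul_mul_tmul, mul_one, one_mul]
        rfl
      rw [h3, ← mul_sub, ← map_pow]
      exact mul_mem_fil (algebraMap_mem_fil p O (Ideal.pow_mem_pow hϖ' h)) h2
    have h4 := ((isLead_lead (p := p) (hϖ := hϖ) (h := h) t).add h1).sub
      (isLead_lead (p := p) (hϖ := hϖ) (h := h) (t + c))
    rw [sub_self, isLead_zero_iff] at h4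
    have h5 := fil_anti p O (show h + 1 ≤ h + h by omega)
      (mul_mem_fil (hϖh v) (lead_mem_fil hϖ h t))
    rw [coverLift, coverLift, twist_same, twist_same, level_self]
    convert Ideal.mul_mem_left _ (shift hϖ h (fun l => bigMap p O
      (g.comp (IsScalarTower.toAlgHom (ResidueField O) Y.carrier Y.Aff)) (Y.lift l))
      (fun i => g (MvPolynomial.X i)) m) (add_mem h4 h5) using 1
    ring
  · rw [coverLift, coverLift, twist_of_ne _ _ hl, twist_of_ne _ _ hl, level_of_ne hl,
      Nat.add_sub_cancel, add_mul, one_mul, add_sub_cancel_left, mul_assoc]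
    exact hϖh _

/-- The translation `root ↦ root + translation y` describes the action of `1 + ϖʰ y`. -/
lemma succ_actHom (hh : 1 ≤ h) {z : Z p O ϖ n Ω (h + 1)} {y : OL p O n Ω}
    (hz : IsOneAdd h z y) :
    (∀ b : Y.Aff, (Y.succ hϖ hh).actHom hϖ' z (AdjoinRoot.of (Y.poly hϖ hh) b) =
      AdjoinRoot.of (Y.poly hϖ hh) b) ∧
    (Y.succ hϖ hh).actHom hϖ' z (AdjoinRoot.root (Y.poly hϖ hh)) =
      AdjoinRoot.root (Y.poly hϖ hh) +
        AdjoinRoot.of (Y.poly hϖ hh) (algebraMap Ω Y.Aff (translation hϖ h y)) := by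
  let f : Y.Succ hϖ hh →ₐ[Ω] Y.Succ hϖ hh := (Y.succ hϖ hh).actHom hϖ' z
  have h1 := (Y.coverPoint_map hh _ _ (Y.root_pow_eq hϖ hh)
    (f.restrictScalars (ResidueField O))).symm.trans
    (((Y.succ hϖ hh).map_ofPoint ((Y.succ hϖ hh).point.act hϖ' z)).trans
      (Y.coverPoint_act hh hz _ _ (Y.root_pow_eq hϖ hh)))
  have h2 := Y.coverPoint_injective hh
    (g := f.comp (IsScalarTower.toAlgHom Ω Y.Aff (Y.Succ hϖ hh)))
    (g' := IsScalarTower.toAlgHom Ω Y.Aff (Y.Succ hϖ hh)) _ _ h1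
  exact ⟨fun b => AlgHom.congr_fun h2.1 b, h2.2⟩

omit [NeZero n] in
lemma natDegree_poly_aux {B : Type*} [CommRing B] [Nontrivial B] {q : ℕ} (hq : 1 < q) (f : B) :
    (Polynomial.X ^ q - Polynomial.X + Polynomial.C f : Polynomial B).Monic ∧
    (Polynomial.X ^ q - Polynomial.X + Polynomial.C f : Polynomial B).natDegree = q := by
  have h1 : (Polynomial.X ^ q - Polynomial.X + Polynomial.C f : Polynomial B) =
      Polynomial.X ^ q + (- Polynomial.X + Polynomial.C f) := by ring
  have h2 : (- Polynomial.X + Polynomial.C f : Polynomial B).degree < (q : ℕ) := by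
    refine lt_of_le_of_lt (b := (1 : WithBot ℕ)) (by compute_degree) ?_
    exact_mod_cast hq
  rw [h1]
  refine ⟨Polynomial.monic_X_pow_add h2, ?_⟩
  rw [Polynomial.natDegree_add_eq_left_of_degree_lt, Polynomial.natDegree_X_pow]
  rwa [Polynomial.degree_X_pow]

lemma monic_poly (hϖ : Irreducible ϖ) (hh : 1 ≤ h) [Nontrivial Y.Aff] : (Y.poly hϖ hh).Monic :=
  (natDegree_poly_aux
    (Nat.one_lt_pow (NeZero.ne n) (Finite.one_lt_card (α := ResidueField O))) _).1

lemma natDegree_poly (hϖ : Irreducible ϖ) (hh : 1 ≤ h) [Nontrivial Y.Aff] :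
    (Y.poly hϖ hh).natDegree = Nat.card (ResidueField O) ^ n :=
  (natDegree_poly_aux
    (Nat.one_lt_pow (NeZero.ne n) (Finite.one_lt_card (α := ResidueField O))) _).2

lemma of_injective (hϖ : Irreducible ϖ) (hh : 1 ≤ h) :
    Function.Injective (AdjoinRoot.of (Y.poly hϖ hh)) := by
  rcases subsingleton_or_nontrivial Y.Aff with hB | hB
  · exact Function.injective_of_subsingleton _
  · refine adjoinRoot_of_injective (Y.monic_poly hϖ hh) ?_
    rw [natDegree_poly]
    exact pow_pos Nat.card_pos _

/-- The invariants of `W_{h+1}` in the coordinate ring of `X̃_{h+1}` are the functions on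
`X̃_h × 𝔸ⁿ⁻¹`. -/
lemma mem_invariants_succ_iff [IsAlgClosed Ω] (hϖ : Irreducible ϖ) (hϖ' : ϖ ∈ maximalIdeal O)
    (hh : 1 ≤ h) {a : Y.Succ hϖ hh} :
    a ∈ (Y.succ hϖ hh).invariants hϖ' ↔ ∃ b, AdjoinRoot.of (Y.poly hϖ hh) b = a := by
  have hinv := (Y.succ hϖ hh).mem_invariants_iff hϖ' (a := a)
  refine hinv.trans ⟨fun ha => ?_, ?_⟩
  · rcases subsingleton_or_nontrivial Y.Aff with hB | hB
    · have : Subsingleton (Y.Succ hϖ hh) :=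
        (AdjoinRoot.mk_surjective (g := Y.poly hϖ hh)).subsingleton
      exact ⟨0, Subsingleton.elim _ _⟩
    -- The available translations number `q ^ n`, exactly the degree of the defining polynomial, as
    -- `mem_range_of_of_translation` requires.
    obtain ⟨s, hs, hs'⟩ := exists_finset_pow_card_pow_eq (ResidueField O) p Ω n
    refine mem_range_of_of_translation (k := Ω) (Y.monic_poly hϖ hh) ?_ s
      ((Y.natDegree_poly hϖ hh).trans hs.symm).le a fun c hc => ?_
    · rw [natDegree_poly]
      exact pow_pos Nat.card_pos _
    · obtain ⟨y, hy⟩ := exists_translation_eq (p := p) (hϖ := hϖ) (h := h) (hs' c hc)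
      obtain ⟨w, hw, hwy⟩ := exists_mem_W (ϖ := ϖ) hh y
      have h2 := Y.succ_actHom (hϖ := hϖ) (hϖ' := hϖ') hh hwy
      refine ⟨((Y.succ hϖ hh).actHom hϖ' w :
        (Y.succ hϖ hh).carrier →+* (Y.succ hϖ hh).carrier), h2.1, ?_, ha w hw⟩
      rw [hy] at h2
      exact h2.2
  · rintro ⟨b, rfl⟩ w hw
    obtain ⟨y, hy⟩ := exists_isOneAdd_of_mem_W hw
    exact (Y.succ_actHom (hϖ := hϖ) (hϖ' := hϖ') hh hy).1 b

variable (X : CoordRing p O ϖ n m Ω (h + 1))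

/-- The homomorphism from the functions on `X̃_h × 𝔸ⁿ⁻¹` to the functions on `X̃_{h+1}`. -/
def affTo (hϖ : Irreducible ϖ) (hh : 1 ≤ h) : Y.Aff →+* X.carrier :=
  RingHom.comp ((X.equiv (Y.succ hϖ hh)).symm : (Y.succ hϖ hh).carrier →+* X.carrier)
    (AdjoinRoot.of (Y.poly hϖ hh))

lemma affTo_injective (hϖ : Irreducible ϖ) (hh : 1 ≤ h) : Function.Injective (Y.affTo X hϖ hh) :=
  (X.equiv (Y.succ hϖ hh)).symm.injective.comp (Y.of_injective hϖ hh)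

lemma mem_invariants_iff_affTo [IsAlgClosed Ω] (hϖ : Irreducible ϖ) (hϖ' : ϖ ∈ maximalIdeal O)
    (hh : 1 ≤ h) {a : X.carrier} :
    a ∈ X.invariants hϖ' ↔ ∃ b, Y.affTo X hϖ hh b = a := by
  have h1 : a ∈ X.invariants hϖ' ↔
      X.equiv (Y.succ hϖ hh) a ∈ (Y.succ hϖ hh).invariants hϖ' := by
    rw [mem_invariants_iff, mem_invariants_iff]
    refine forall₂_congr fun w _ => ?_
    rw [← equiv_actHom, EmbeddingLike.apply_eq_iff_eq]
  rw [h1]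
  refine (Y.mem_invariants_succ_iff hϖ hϖ' hh).trans (exists_congr fun b => ?_)
  exact ((X.equiv (Y.succ hϖ hh)).symm_apply_eq (x := AdjoinRoot.of (Y.poly hϖ hh) b)
    (y := a)).symm

lemma ofPoint_comp_eq {i j : ℕ} (hij : i ≤ j) (X X' : CoordRing p O ϖ n m Ω j)
    (Y : CoordRing p O ϖ n m Ω i) (f : Y.carrier →ₐ[Ω] X'.carrier)
    (hf : X'.point.red hij = Y.point.map (f.restrictScalars (ResidueField O))) :
    (X'.ofPoint X.point).comp f = Y.ofPoint (X.point.red hij) := by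
  apply Y.hom_ext
  have h1 := Point.map_map Y.point (f.restrictScalars (ResidueField O))
    ((X'.ofPoint X.point).restrictScalars (ResidueField O))
  rw [← hf, ← Point.red_map, map_ofPoint] at h1
  rw [map_ofPoint]
  exact h1.symm

/-- On constants the map is the transition morphism, so the description of the quotient is one over
`X̃_h`. -/
lemma affTo_C (hϖ : Irreducible ϖ) (hh : 1 ≤ h) (b : Y.carrier) :
    Y.affTo X hϖ hh (MvPolynomial.C b) = Y.ofPoint (X.point.red (Nat.le_succ h)) b :=
  AlgHom.congr_fun (ofPoint_comp_eq (Nat.le_succ h) X (Y.succ hϖ hh) Y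
    ((IsScalarTower.toAlgHom Ω Y.Aff (Y.Succ hϖ hh)).comp
      (IsScalarTower.toAlgHom Ω Y.carrier Y.Aff))
    (Y.coverPoint_red hh (IsScalarTower.toAlgHom (ResidueField O) Y.Aff (Y.Succ hϖ hh)) _
      (Y.root_pow_eq hϖ hh))) b

/-- The ring of invariants is isomorphic to the ring of functions on `X̃_h × 𝔸ⁿ⁻¹`. -/
def affEquiv [IsAlgClosed Ω] (hϖ : Irreducible ϖ) (hϖ' : ϖ ∈ maximalIdeal O) (hh : 1 ≤ h) :
    Y.Aff ≃+* X.invariants hϖ' :=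
  RingEquiv.ofBijective ((Y.affTo X hϖ hh).codRestrict (X.invariants hϖ')
    fun b => (Y.mem_invariants_iff_affTo X hϖ hϖ' hh).2 ⟨b, rfl⟩) (by
    refine ⟨fun b b' hb => Y.affTo_injective X hϖ hh (congrArg Subtype.val hb), fun a => ?_⟩
    obtain ⟨b, hb⟩ := (Y.mem_invariants_iff_affTo X hϖ hϖ' hh).1 a.2
    exact ⟨b, Subtype.ext hb⟩)

lemma affEquiv_C [IsAlgClosed Ω] (hϖ : Irreducible ϖ) (hϖ' : ϖ ∈ maximalIdeal O) (hh : 1 ≤ h)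
    (b : Y.carrier) : (Y.affEquiv X hϖ hϖ' hh (MvPolynomial.C b) : X.carrier) =
      Y.ofPoint (X.point.red (Nat.le_succ h)) b :=
  Y.affTo_C X hϖ hh b

end CoordRing

end CoverAction

/-! ### The quotient `W_{h+1} \ X̃_{h+1}` as an affine space over `X̃_h` -/

section AffineBundle

open Limits

lemma smooth_affineSpace_Spec (n : Type u) [Finite n] (B : CommRingCat.{u}) :
    Smooth (𝔸(n; Spec B) ↘ Spec B) := by
  have h1 : Smooth (Spec.map (CommRingCat.ofHom (MvPolynomial.C : B →+* MvPolynomial n B))) := by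
    rw [HasRingHomProperty.Spec_iff (P := @Smooth)]
    change RingHom.Smooth (algebraMap B (MvPolynomial n B))
    rw [RingHom.smooth_algebraMap]
    exact ⟨inferInstance, inferInstance⟩
  rw [← AffineSpace.SpecIso_inv_over] at h1
  have h2 := smooth_comp (AffineSpace.SpecIso n B).hom
    ((AffineSpace.SpecIso n B).inv ≫ 𝔸(n; Spec B) ↘ Spec B)
  rwa [Iso.hom_inv_id_assoc] at h2

/-- A ring isomorphism with a polynomial ring gives an isomorphism with affine space. -/
lemma exists_iso_affineSpace {I : Type*} {J : Type u} (σ : I ≃ J) {B A : Type u} [CommRing B]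
    [CommRing A] (e : MvPolynomial I B ≃+* A) :
    ∃ f : Spec (.of A) ≅ 𝔸(J; Spec (.of B)), f.hom ≫ (𝔸(J; Spec (.of B)) ↘ Spec (.of B)) =
      Spec.map (CommRingCat.ofHom ((e : MvPolynomial I B →+* A).comp MvPolynomial.C)) := by
  let e' : MvPolynomial J B ≃+* A :=
    (MvPolynomial.renameEquiv B σ).symm.toRingEquiv.trans e
  refine ⟨Scheme.Spec.mapIso e'.toCommRingCatIso.op ≪≫ (AffineSpace.SpecIso J (.of B)).symm, ?_⟩
  rw [Iso.trans_hom, Category.assoc, Iso.symm_hom, AffineSpace.SpecIso_inv_over]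
  change Spec.map (CommRingCat.ofHom (e' : MvPolynomial J B →+* A)) ≫ _ = _
  rw [← Spec.map_comp, ← CommRingCat.ofHom_comp]
  congr 2
  ext b
  simp [e']

/-- A scheme which is isomorphic to affine space over an affine base has affine spaces as
fibers. -/
lemma exists_pullback_iso_affineSpace {J : Type u} {X S T : Scheme.{u}} {g : X ⟶ S}
    (e : X ≅ 𝔸(J; S)) (he : e.hom ≫ (𝔸(J; S) ↘ S) = g) (y : T ⟶ S) :
    ∃ f : pullback g y ≅ 𝔸(J; T), f.hom ≫ (𝔸(J; T) ↘ T) = pullback.snd g y := by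
  have h1 : IsPullback (AffineSpace.map J y ≫ e.inv) (𝔸(J; T) ↘ T) g y :=
    IsPullback.of_iso (AffineSpace.isPullback_map (n := J) y) (Iso.refl _) e.symm (Iso.refl _)
      (Iso.refl _) (by simp) (by simp) (by simp [← he]) (by simp)
  refine ⟨h1.isoPullback.symm, ?_⟩
  exact h1.isoPullback_inv_snd

end AffineBundle

/-! ### The induced morphism from the quotient -/

section Main

open Limits

variable {p : ℕ} [Fact p.Prime] {O : Type u} [CommRing O] [IsDomain O] [IsDiscreteValuationRing O]
  [CharP (ResidueField O) p] {ϖ : O}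
  [Finite (ResidueField O)] [IsAdicComplete (maximalIdeal O) O]
  {h n : ℕ} {m : ℤ} {Ω : Type u} [Field Ω] [Algebra (ResidueField O) Ω] [IsAlgClosed Ω]
  [NeZero n]

lemma exists_equiv_ulift_fin (n : ℕ) [NeZero n] (m : ℤ) :
    Nonempty ({l : ZMod n // l ≠ m} ≃ ULift.{u} (Fin (n - 1))) := by
  have h1 : Fintype.card {l : ZMod n // l ≠ m} = Fintype.card (ULift.{u} (Fin (n - 1))) := by
    rw [Fintype.card_subtype_compl, ZMod.card, Fintype.card_ulift, Fintype.card_fin,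
      Fintype.card_subtype_eq]
  exact ⟨Fintype.equivOfCardEq h1⟩

namespace CoordRing

/-- Functions pulled back from `X̃_h` are the constants of the polynomial ring of invariants, hence
fixed by `W_{h+1}`. -/
lemma act_trans (hϖ : Irreducible ϖ) (hϖ' : ϖ ∈ maximalIdeal O) (hh : 1 ≤ h)
    (X : CoordRing p O ϖ n m Ω (h + 1)) (Y : CoordRing p O ϖ n m Ω h)
    {w : Z p O ϖ n Ω (h + 1)} (hw : w ∈ W p O ϖ n Ω (h + 1)) :
    X.act hϖ' w ≫ X.trans (Nat.le_succ h) Y = X.trans (Nat.le_succ h) Y := by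
  refine (Spec.map_comp _ _).symm.trans (congrArg Spec.map ?_)
  rw [← CommRingCat.ofHom_comp]
  congr 1
  refine RingHom.ext fun b => ?_
  change X.actHom hϖ' w (Y.ofPoint (X.point.red (Nat.le_succ h)) b) =
    Y.ofPoint (X.point.red (Nat.le_succ h)) b
  rw [← Y.affEquiv_C X hϖ hϖ' hh]
  exact (X.mem_invariants_iff hϖ').1 (Y.affEquiv X hϖ hϖ' hh (MvPolynomial.C b)).2 w hw

theorem exists_quot_iso (hϖ : Irreducible ϖ) (hϖ' : ϖ ∈ maximalIdeal O) (hh : 1 ≤ h)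
    (X : CoordRing p O ϖ n m Ω (h + 1)) (Y : CoordRing p O ϖ n m Ω h) :
    ∃ g : X.quot hϖ' ⟶ Y.scheme,
      X.toQuot hϖ' ≫ g = X.trans (Nat.le_succ h) Y ∧
      Smooth g ∧
      (∀ (F : Type u) [Field F] (y : Spec (.of F) ⟶ Y.scheme),
        ∃ e : pullback g y ≅ 𝔸(ULift.{u} (Fin (n - 1)); Spec (.of F)),
          e.hom ≫ (𝔸(ULift.{u} (Fin (n - 1)); Spec (.of F)) ↘ Spec (.of F)) =
            pullback.snd g y) ∧
      ∃ e : X.quot hϖ' ≅ 𝔸(ULift.{u} (Fin (n - 1)); Y.scheme),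
        e.hom ≫ (𝔸(ULift.{u} (Fin (n - 1)); Y.scheme) ↘ Y.scheme) = g := by
  obtain ⟨σ⟩ := exists_equiv_ulift_fin.{u} n m
  obtain ⟨e, he⟩ := exists_iso_affineSpace σ (Y.affEquiv X hϖ hϖ' hh)
  refine ⟨Spec.map (CommRingCat.ofHom ((Y.affEquiv X hϖ hϖ' hh :
    Y.Aff →+* X.invariants hϖ').comp MvPolynomial.C)), ?_, ?_, ?_, e, he⟩
  · rw [toQuot, trans]
    refine (Spec.map_comp _ _).symm.trans (congrArg Spec.map ?_)
    rw [← CommRingCat.ofHom_comp]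
    congr 1
    exact RingHom.ext fun b => Y.affEquiv_C X hϖ hϖ' hh b
  · rw [← he]
    have := smooth_affineSpace_Spec (ULift.{u} (Fin (n - 1))) (.of Y.carrier)
    exact MorphismProperty.comp_mem @Smooth e.hom _ inferInstance this
  · intro F _ y
    exact exists_pullback_iso_affineSpace e he y

end CoordRing

end Main

end

end DivisionLusztig

theorem lemmal
    -- `K` is a local field with residue field `𝔽_q` of characteristic `p` and uniformizer `ϖ`.
    {K : Type u} [Field K] [ValuativeRel K] [TopologicalSpace K] [IsNonarchimedeanLocalField K]
    (p : ℕ) [Fact p.Prime] [CharP (ResidueField 𝒪[K]) p] (ϖ : 𝒪[K]) (hϖ : Irreducible ϖ)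
    -- `Ω` is an algebraic closure of the residue field, `n ≥ 1` and `m` is an integer.
    (Ω : Type u) [Field Ω] [Algebra (ResidueField 𝒪[K]) Ω] [IsAlgClosure (ResidueField 𝒪[K]) Ω]
    (n : ℕ) [NeZero n] (m : ℤ) :
    -- For `h ≥ 1` the scheme `X̃^{(m)}_h` exists, and it is of finite type over `Ω`.
    (∀ h : ℕ, 1 ≤ h →
      ∃ X : CoordRing p 𝒪[K] ϖ n m Ω h, Algebra.FiniteType Ω X.carrier) ∧
    ∀ h : ℕ, 2 ≤ h → ∀ (X : CoordRing p 𝒪[K] ϖ n m Ω h) (Y : CoordRing p 𝒪[K] ϖ n m Ω (h - 1)),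
      -- The action of `W_h` preserves the fibers of `X̃^{(m)}_h → X̃^{(m)}_{h-1}`.
      (∀ w ∈ W p 𝒪[K] ϖ n Ω h,
        X.act hϖ.not_isUnit w ≫ X.trans (Nat.sub_le h 1) Y = X.trans (Nat.sub_le h 1) Y) ∧
      -- The induced morphism `g : W_h \ X̃^{(m)}_h → X̃^{(m)}_{h-1}`:
      ∃ g : X.quot hϖ.not_isUnit ⟶ Y.scheme,
        X.toQuot hϖ.not_isUnit ≫ g = X.trans (Nat.sub_le h 1) Y ∧
        -- it is smooth;
        Smooth g ∧
        -- each of its fibers, over any field-valued point, is an affine space `𝔸ⁿ⁻¹`;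
        (∀ (F : Type u) [Field F] (y : Spec (.of F) ⟶ Y.scheme),
          ∃ e : pullback g y ≅ 𝔸(ULift.{u} (Fin (n - 1)); Spec (.of F)),
            e.hom ≫ (𝔸(ULift.{u} (Fin (n - 1)); Spec (.of F)) ↘ Spec (.of F)) =
              pullback.snd g y) ∧
        -- and `W_h \ X̃^{(m)}_h` is isomorphic over `X̃^{(m)}_{h-1}` to `X̃^{(m)}_{h-1} × 𝔸ⁿ⁻¹`.
        ∃ e : X.quot hϖ.not_isUnit ≅ 𝔸(ULift.{u} (Fin (n - 1)); Y.scheme),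
          e.hom ≫ (𝔸(ULift.{u} (Fin (n - 1)); Y.scheme) ↘ Y.scheme) = g := by
  have : IsAlgClosed Ω := IsAlgClosure.isAlgClosed (ResidueField 𝒪[K])
  refine ⟨fun h hh => exists_coordRing p n m Ω hϖ h hh, fun h hh X Y => ?_⟩
  obtain ⟨k, rfl⟩ : ∃ k, h = k + 1 := ⟨h - 1, by omega⟩
  have hk : 1 ≤ k := by omega
  exact ⟨fun w hw => CoordRing.act_trans hϖ hϖ.not_isUnit hk X Y hw,
    CoordRing.exists_quot_iso hϖ hϖ.not_isUnit hk X Y⟩
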